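/- Let $\tau$ be a (finite, oriented, cooriented) veering ideal triangulation with exactly one cusp. Its faces cut the boundary torus into the triangles of a boundary triangulation $L$, whose vertices are the ends of edges of $\tau$ and whose edges come from corners of faces of $\tau$; the coorientation makes $L$ a cooriented train track, whose branches we direct from left to right so that the coorientation points up. An edge of $L$ is a ladderpole edge if its two ends lie on edges of $\tau$ of the same colour, and a rung otherwise; the ladderpoles are the connected components of the union of the ladderpole edges. A ladderpole is upward if at each of its vertices the rungs on the left are smoothed upward and the rungs on the right are smoothed downward, so that the left-to-right direction ascends along it, and it is downward if the opposite holds. Suppose that $L$ has exactly one upward and exactly one downward ladderpole. Coordinates. Draw $L$ on $\mathbb R^2/\mathbb Z^2$ so that each ladderpole is a vertical line that closes up after height $1$ (so the degeneracy slope is $\infty$), the left-to-right direction being up on the upward ladderpole and down on the downward one, so that left-to-right rungs cross the two ladders (the annuli between the ladderpoles) from left to right, and so that no rung rises or falls by more than $1$. Slopes are measured in the coordinates of any such picture. Solutions. For an edge $e$ of $\tau$ let $n_e$ and $m_e$ be the numbers of faces in the two fans at $e$ (the two groups into which the faces at $e$ are split by the two dihedral angles $\pi$). A solution to the holonomy problem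 is a choice of an orientation-preserving homeomorphism $f_e:[0,n_e]\to[0,m_e]$ for each edge $e$. It determines a foliation of the boundary torus carried by $L$: each branch of $L$ is replaced by a foliated strip $(\text{branch})\times[0,1]$, and at an end of $e$ the $n_e$ strips of one fan, stacked in the order of the coorientation, are glued to the $m_e$ stacked strips of the other fan by $f_e$. (The fan $n_e$ is on the left at one end of $e$ and on the right at the other end; so, from left to right, the gluing is $f_e$ at one end and $f_e^{-1}$ at the other.) The slope of this foliation is the asymptotic slope, in $\mathbb R\cup\{\infty\}$, of the lifts of its leaves to the plane. Then for every solution to the holonomy problem the boundary foliation has a well-defined slope $s$ (all lifts of leaves have the same asymptotic slope $s$, in both directions); this slope is finite, and $-4<s<4$. -/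

import Mathlib

open Equiv Equiv.Perm Filter Topology Set

noncomputable section

/-! ### Veering triangulations -/

/-- An oriented ideal triangulation with set of tetrahedra `T`. The ideal vertices of each
tetrahedron are numbered by `Fin 4` compatibly with the orientation; face `i` is the one opposite
to vertex `i`. Face `i` of `t` is glued to face `glue t i i` of `adj t i`, each vertex `j ≠ i` of
`t` going to the vertex `glue t i j`; gluings reverse the orientation of faces, which means that
the permutation `glue t i` is odd. -/
structure IdealTriangulation (T : Type*) where
  adj : T → Fin 4 → T
  glue : T → Fin 4 → Perm (Fin 4)
  adj_adj : ∀ t i, adj (adj t i) (glue t i i) = t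
  glue_glue : ∀ t i, glue (adj t i) (glue t i i) = (glue t i)⁻¹
  sign_glue : ∀ t i, sign (glue t i) = -1

/-- A corner of the boundary triangulation. The pair `(t, p)`, with `p` an even permutation, is the
corner at the edge `p 0 ⟶ p 1` of the triangle that truncates the vertex `p 0` of `t`. The other
two corners of that triangle are at the edges `p 0 ⟶ p 2` and `p 0 ⟶ p 3`, and the three corners
`p 1, p 2, p 3` are in counterclockwise order. The two sides of the triangle at this corner lie in
the faces `p 3` (joining the corners `p 1`, `p 2`) and `p 2` (joining the corners `p 1`, `p 3`); a
counterclockwise turn around the corner enters through the face `p 3` and exits through the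
face `p 2`.

A corner is also used as a name of a half-edge of the boundary triangulation: the side in the
face `p 2`, seen from its end at the edge `p 0 ⟶ p 1`. -/
abbrev BdryCorner (T : Type*) := T × alternatingGroup (Fin 4)

namespace BdryCorner

variable {T : Type*}

/-- The next corner of the same triangle: it is the other end of the side in the face `p 2`. -/
def next (c : BdryCorner T) : BdryCorner T :=
  (c.1, ⟨c.2.1 * (swap 1 2 * swap 1 3), by
    have h : sign (c.2 : Perm (Fin 4)) = 1 := mem_alternatingGroup.1 c.2.2
    rw [mem_alternatingGroup, Perm.sign_mul, h]
    decide⟩)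

/-- The same corner of the tetrahedron, at the other end of the edge: `p 0` and `p 1` are
interchanged (and so are `p 2` and `p 3`). -/
def rev (c : BdryCorner T) : BdryCorner T :=
  (c.1, ⟨c.2.1 * (swap 0 1 * swap 2 3), by
    have h : sign (c.2 : Perm (Fin 4)) = 1 := mem_alternatingGroup.1 c.2.2
    rw [mem_alternatingGroup, Perm.sign_mul, h]
    decide⟩)

end BdryCorner

namespace IdealTriangulation

variable {T : Type*} (τ : IdealTriangulation T)

/-- Cross the face `k` of `t` and then exchange two of the labels. -/
def cross (t : T) (k : Fin 4) (p : alternatingGroup (Fin 4)) (a b : Fin 4) (hab : a ≠ b) :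
    BdryCorner T :=
  (τ.adj t k, ⟨τ.glue t k * p.1 * swap a b, by
    have h : sign (p : Perm (Fin 4)) = 1 := mem_alternatingGroup.1 p.2
    rw [mem_alternatingGroup, Perm.sign_mul, Perm.sign_mul, h, τ.sign_glue, sign_swap hab]
    decide⟩)

theorem cross_cross (t : T) (k l : Fin 4) (p : alternatingGroup (Fin 4)) (a b : Fin 4)
    (hab : a ≠ b) (hl : l = τ.glue t k k) :
    τ.cross (τ.cross t k p a b hab).1 l (τ.cross t k p a b hab).2 a b hab = (t, p) := by
  subst hl
  refine Prod.ext (τ.adj_adj t k) (Subtype.ext ?_)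
  change τ.glue (τ.adj t k) (τ.glue t k k) * (τ.glue t k * p * swap a b) * swap a b = p
  rw [τ.glue_glue]
  simp [mul_assoc]

/-- The counterclockwise turn around a vertex of the boundary triangulation, that is, around an
edge of the triangulation: the corner after `c` (they share the side in the face `p 2`). -/
def rot : Perm (BdryCorner T) where
  toFun c := τ.cross c.1 (c.2.1 2) c.2 2 3 (by decide)
  invFun c := τ.cross c.1 (c.2.1 3) c.2 2 3 (by decide)
  left_inv c := τ.cross_cross _ _ _ _ _ _ _ (by simp [cross])
  right_inv c := τ.cross_cross _ _ _ _ _ _ _ (by simp [cross])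

/-- The other half of a half-edge of the boundary triangulation. -/
def opp (c : BdryCorner T) : BdryCorner T :=
  τ.cross c.1 (c.2.1 2) c.2 1 3 (by decide)

/-- Vertices of the boundary triangulation. A vertex is an end of an edge of the triangulation, or
equivalently an edge of the triangulation together with a direction. -/
abbrev BdryVertex := Quotient (SameCycle.setoid τ.rot)

/-- The vertex of the boundary triangulation at a corner. -/
def vertex (c : BdryCorner T) : τ.BdryVertex := Quotient.mk _ c

/-- The cusps, i.e. the connected components of the boundary triangulation; `(t, i)` is the
triangle that truncates the vertex `i` of `t`. -/
def Cusp := Quot fun a b : T × Fin 4 =>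
  ∃ k, k ≠ a.2 ∧ b = (τ.adj a.1 k, τ.glue a.1 k a.2)

/-- The triangulated manifold has exactly one cusp. -/
def OneCusped : Prop := Nat.card τ.Cusp = 1

end IdealTriangulation

/-- A (transverse, i.e. cooriented) veering triangulation.

* `out t i` says that face `i` of `t` is cooriented out of `t`. Two faces of each tetrahedron are
  cooriented outwards and two inwards. The dihedral angle of `t` between two faces is `π` if both
  point out or both point in, and is `0` otherwise.
* `taut`: the angles around each edge add up to `2π`, that is, exactly two of them are `π`.
* `red t i j` says that the edge `i j` of `t` is red rather than blue; it is a well-defined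
  colouring of the edges of the triangulation.
* `veer`: the four edges of angle `0` of each tetrahedron are alternately red and blue, in the
  manner fixed by the orientation. -/
structure VeeringTriangulation (T : Type*) extends IdealTriangulation T where
  out : T → Fin 4 → Bool
  out_glue : ∀ t i, out (adj t i) (glue t i i) = !out t i
  two_out : ∀ t, (Finset.univ.filter fun i => out t i = true).card = 2
  taut : ∀ c : BdryCorner T, Nat.card {d : BdryCorner T // toIdealTriangulation.rot.SameCycle c d ∧
    out d.1 (d.2.1 2) = out d.1 (d.2.1 3)} = 2
  red : T → Fin 4 → Fin 4 → Bool
  red_symm : ∀ t i j, red t i j = red t j i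
  red_glue : ∀ t i j k, j ≠ i → k ≠ i → red (adj t i) (glue t i j) (glue t i k) = red t j k
  veer : ∀ c : BdryCorner T, out c.1 (c.2.1 2) = out c.1 (c.2.1 3) →
    red c.1 (c.2.1 0) (c.2.1 2) = true ∧ red c.1 (c.2.1 0) (c.2.1 3) = false

namespace VeeringTriangulation

variable {T : Type*} (τ : VeeringTriangulation T)

/-! ### The boundary train track and its ladderpoles

The coorientation makes the boundary triangulation a cooriented train track, and we direct its
branches from left to right so that the coorientation points up. At a vertex, the branches to the
right are those whose coorientation is counterclockwise around the vertex; the branches to the left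
are those whose coorientation is clockwise. The two groups are separated by the two angles `π`, and
they are the two fans of the corresponding edge of the triangulation. -/

/-- The half-edge `c` leaves its vertex to the right, so `c` is the left end of its branch. Branches
of the train track are named by their left ends. -/
def IsRight (c : BdryCorner T) : Prop := τ.out c.1 (c.2.1 2) = true

/-- The number of branches to the left of a vertex. -/
def leftSize (v : τ.BdryVertex) : ℕ :=
  Nat.card {c : BdryCorner T // τ.vertex c = v ∧ ¬ τ.IsRight c}

/-- The number of branches to the right of a vertex. -/
def rightSize (v : τ.BdryVertex) : ℕ :=
  Nat.card {c : BdryCorner T // τ.vertex c = v ∧ τ.IsRight c}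

/-- The number of branches below the half-edge `c` on the right of its vertex. (Turning clockwise,
one meets these branches before the first branch on the left.) -/
def rightPos (c : BdryCorner T) : ℕ := sInf {k : ℕ | ¬ τ.IsRight ((τ.rot⁻¹ ^ (k + 1)) c)}

/-- The number of branches below the half-edge `c` on the left of its vertex. (Turning
counterclockwise, one meets these branches before the first branch on the right.) -/
def leftPos (c : BdryCorner T) : ℕ := sInf {k : ℕ | τ.IsRight ((τ.rot ^ (k + 1)) c)}

/-- The half-edge `c` belongs to a ladderpole: its two ends have the same colour. The other edges
of the boundary triangulation are the rungs. -/
def IsPole (c : BdryCorner T) : Prop :=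
  τ.red c.1 (c.2.1 0) (c.2.1 1) =
    τ.red (τ.opp c).1 ((τ.opp c).2.1 0) ((τ.opp c).2.1 1)

/-- The ladderpoles: the connected components of the union of the ladderpole edges. -/
def Ladderpole := Quot fun v w : τ.BdryVertex =>
  ∃ c, τ.IsPole c ∧ τ.vertex c = v ∧ τ.vertex (τ.opp c) = w

/-- The ladderpole through a vertex. -/
def ladderpole (v : τ.BdryVertex) : τ.Ladderpole := Quot.mk _ v

/-- The ladderpole `q` is upward: at each vertex, the ladderpole edge on the right lies above all
the rungs on the right (they are smoothed downward), and the ladderpole edge on the left lies below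
all the rungs on the left (they are smoothed upward). -/
def IsUpward (q : τ.Ladderpole) : Prop :=
  ∀ c d : BdryCorner T, τ.vertex c = τ.vertex d → τ.ladderpole (τ.vertex c) = q →
    τ.IsPole c → ¬ τ.IsPole d →
      (τ.IsRight c → τ.IsRight d → τ.rightPos d < τ.rightPos c) ∧
      (¬ τ.IsRight c → ¬ τ.IsRight d → τ.leftPos c < τ.leftPos d)

/-- The ladderpole `q` is downward: the opposite smoothing. -/
def IsDownward (q : τ.Ladderpole) : Prop :=
  ∀ c d : BdryCorner T, τ.vertex c = τ.vertex d → τ.ladderpole (τ.vertex c) = q →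
    τ.IsPole c → ¬ τ.IsPole d →
      (τ.IsRight c → τ.IsRight d → τ.rightPos c < τ.rightPos d) ∧
      (¬ τ.IsRight c → ¬ τ.IsRight d → τ.leftPos d < τ.leftPos c)

/-! ### Coordinates on the boundary torus -/

/-- Vertical coordinates for a drawing of the boundary triangulation in a rectangle of height `1`
with opposite sides identified: the height of each vertex, and the (signed) number of times that
each edge crosses the top side of the rectangle. The sides of a triangle close up in the plane. -/
structure Drawing where
  height : τ.BdryVertex → ℝ
  wrap : BdryCorner T → ℤ
  wrap_opp : ∀ c, wrap (τ.opp c) = -wrap c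
  wrap_triangle : ∀ c : BdryCorner T, wrap c + wrap c.next + wrap c.next.next = 0

namespace Drawing

variable {τ} (D : τ.Drawing)

/-- By how much an edge rises in the plane, from the end at `c` to the other end. -/
def rise (c : BdryCorner T) : ℝ :=
  D.height (τ.vertex (τ.opp c)) - D.height (τ.vertex c) + D.wrap c

open Classical in
/-- The coordinates are those of a picture in the unit square with the degeneracy slope vertical:
the upward ladderpole is drawn as a vertical line, pointing up from left to right along the train
track, the downward ladderpole as a vertical line pointing down, each of them closes up after
height `1`, and no rung rises or falls by more than `1` across its ladder. -/
structure IsStandard [Fintype T] : Prop where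
  rise_up : ∀ c, τ.IsRight c → τ.IsPole c → τ.IsUpward (τ.ladderpole (τ.vertex c)) → 0 < D.rise c
  rise_down : ∀ c, τ.IsRight c → τ.IsPole c → τ.IsDownward (τ.ladderpole (τ.vertex c)) →
    D.rise c < 0
  pole_total : ∀ q : τ.Ladderpole,
    ∑ c : BdryCorner T with τ.IsRight c ∧ τ.IsPole c ∧ τ.ladderpole (τ.vertex c) = q,
      |D.rise c| = 1
  rung_le : ∀ c, ¬ τ.IsPole c → |D.rise c| ≤ 1

end Drawing

open Classical in
/-- The horizontal extent of a branch: ladderpoles are vertical, and each of the two ladders has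
width `1 / 2`. -/
def run (c : BdryCorner T) : ℝ := if τ.IsPole c then 0 else 1 / 2

/-! ### The holonomy problem -/

/-- A (candidate) solution to the holonomy problem: an orientation preserving homeomorphism from
one fan to the other, `f_e : [0, n_e] → [0, m_e]`, for each edge `e`. It is recorded at both ends
of `e`, always as a map from the left fan to the right fan as seen at this end. Left and right are
exchanged between the two ends, so the homeomorphisms at the two ends are inverse to each other. -/
structure HolonomySolution where
  f : ∀ v : τ.BdryVertex, Icc (0 : ℝ) (τ.leftSize v) ≃ₜ Icc (0 : ℝ) (τ.rightSize v)
  mono : ∀ v, StrictMono (f v)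
  f_rev : ∀ (c : BdryCorner T) (x : Icc (0 : ℝ) (τ.leftSize (τ.vertex c))),
    ∃ y : Icc (0 : ℝ) (τ.leftSize (τ.vertex c.rev)),
      (y : ℝ) = f (τ.vertex c) x ∧ (f (τ.vertex c.rev) y : ℝ) = x

variable {τ}

/-- A lift to the plane of an integral curve, i.e. of a leaf of the boundary foliation of the
solution `F`. The foliation is made of the foliated branches `branch × [0, 1]`, which are stacked at
each vertex to fans `[0, n]` on the left and `[0, m]` on the right and glued there. The curve
follows from left to right the branches with left ends `… c (-1), c 0, c 1, …`, along the leaves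
at the heights `s n` in `[0, 1]`; and `(x n, y n)` is the point of the plane where the `n`-th of
these branches starts. -/
structure IntegralCurve (F : τ.HolonomySolution) (D : τ.Drawing) where
  c : ℤ → BdryCorner T
  s : ℤ → Icc (0 : ℝ) 1
  isRight : ∀ n, τ.IsRight (c n)
  vertex_succ : ∀ n, τ.vertex (c (n + 1)) = τ.vertex (τ.opp (c n))
  glued : ∀ n, ∃ z : Icc (0 : ℝ) (τ.leftSize (τ.vertex (τ.opp (c n)))),
    (z : ℝ) = τ.leftPos (τ.opp (c n)) + s n ∧
    (F.f (τ.vertex (τ.opp (c n))) z : ℝ) = τ.rightPos (c (n + 1)) + s (n + 1)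
  x : ℤ → ℝ
  y : ℤ → ℝ
  x_succ : ∀ n, x (n + 1) = x n + τ.run (c n)
  y_succ : ∀ n, y (n + 1) = y n + D.rise (c n)

open Classical in
/-- The slope in `ℝ ∪ {∞}` of the vector `(x, y)`. -/
def slopeOf (x y : ℝ) : OnePoint ℝ := if x = 0 then OnePoint.infty else ((y / x : ℝ) : OnePoint ℝ)

/-- The boundary foliation of the solution `F` has slope `σ ∈ ℝ ∪ {∞}`, in the coordinates given by
`D`: there are integral curves, and each lift of an integral curve to the plane has asymptotic
slope `σ`, in both directions. -/
def HolonomySolution.HasBoundarySlope (F : τ.HolonomySolution) (D : τ.Drawing) (σ : OnePoint ℝ) :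
    Prop :=
  Nonempty (IntegralCurve F D) ∧ ∀ γ : IntegralCurve F D,
    Tendsto (fun n => slopeOf (γ.x n) (γ.y n)) atTop (𝓝 σ) ∧
    Tendsto (fun n => slopeOf (γ.x n) (γ.y n)) atBot (𝓝 σ)

end VeeringTriangulation

end

/-!
A curve of the boundary foliation runs from left to right through the two ladders in turn, and on
its way it may follow the ladderpoles for a while. The slope exists because the first return to a
ladder is a monotone map of degree one of a circle, and the slope is its translation number.

*Combinatorics.* In each triangle of the boundary triangulation the place of the angle `π` and the
colours determine each other (`triangle_cases`). Hence a ladderpole edge is the extreme branch of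
its fan, at the top right and the bottom left of red vertices and at the bottom right and the top
left of blue ones (`isPole_iff_polePos`). So red ladderpoles are upward, blue ones are downward, and
by hypothesis the vertices of a colour lie on a single ladderpole, whose lift to the plane is
numbered by the integers (`exists_lift_index`, `PoleIndex`). The rungs of a ladder are in linear
order in the plane, and the order seen from the left ladderpole is the one seen from the right
ladderpole (`nextRung`, `exists_ladder_const`).

*Crossing a ladderpole.* Blue ladderpoles are turned upside down, so that both look like a
`PoleModel`. Leaves do not cross, so the holonomy across a ladderpole is monotone (`Rel.mono`). A
leaf that follows the pole through a vertex enters the left fan on its lowest strip and leaves the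
right fan on its highest strip. The two ends of an edge of the triangulation have the same colour, so
they lie on the same ladderpole, and their gluing maps are inverse to each other. Therefore no leaf
follows the pole through both (`not_follows_pole`), and a leaf rises by at most `1` along a
ladderpole (`height_le_one`).

*The slope.* The holonomy around the torus lifts to a `CircleDeg1Lift` (`turnLift`), and each curve
stays at a bounded distance from a line whose slope is the translation number
(`exists_abs_sub_le`). In one turn, a curve moves up by at most `1` in each of the two ladders and by
at most `1` along the red ladderpole, and it does not move up along the blue one; likewise for moving
down. So the slope is at most `3` in absolute value.
-/

noncomputable section

/-! ### Corners of the boundary triangulation -/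

namespace BdryCorner

variable {T : Type*}

theorem next_next_next (c : BdryCorner T) : c.next.next.next = c := by
  refine Prod.ext rfl (Subtype.ext ?_)
  have h : (swap 1 2 * swap 1 3 * (swap 1 2 * swap 1 3) * (swap 1 2 * swap 1 3) :
    Perm (Fin 4)) = 1 := by decide
  simp only [next, mul_assoc] at h ⊢
  rw [h, mul_one]

theorem rev_rev (c : BdryCorner T) : c.rev.rev = c := by
  refine Prod.ext rfl (Subtype.ext ?_)
  have h : (swap 0 1 * swap 2 3 * (swap 0 1 * swap 2 3) : Perm (Fin 4)) = 1 := by decide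
  simp only [rev, mul_assoc] at h ⊢
  rw [h, mul_one]

theorem rev_ne (c : BdryCorner T) : c.rev ≠ c := by
  intro h
  have h1 : c.rev.2.1 0 = c.2.1 0 := by rw [h]
  have h2 : c.rev.2.1 0 = c.2.1 1 := by
    simp only [rev, Perm.mul_apply]; congr 1
  exact absurd (c.2.1.injective (h1.symm.trans h2)) (by decide)

theorem next_zero (c : BdryCorner T) : c.next.2.1 0 = c.2.1 0 := by
  simp only [next, Perm.mul_apply]; congr 1
theorem next_one (c : BdryCorner T) : c.next.2.1 1 = c.2.1 3 := by
  simp only [next, Perm.mul_apply]; congr 1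
theorem next_two (c : BdryCorner T) : c.next.2.1 2 = c.2.1 1 := by
  simp only [next, Perm.mul_apply]; congr 1
theorem next_three (c : BdryCorner T) : c.next.2.1 3 = c.2.1 2 := by
  simp only [next, Perm.mul_apply]; congr 1

end BdryCorner

namespace IdealTriangulation

variable {T : Type*} (τ : IdealTriangulation T)

theorem rot_apply (c : BdryCorner T) :
    τ.rot c = τ.cross c.1 (c.2.1 2) c.2 2 3 (by decide) := rfl

theorem rot_inv_apply (c : BdryCorner T) :
    τ.rot⁻¹ c = τ.cross c.1 (c.2.1 3) c.2 2 3 (by decide) := rfl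

theorem rot_rot_inv (c : BdryCorner T) : τ.rot (τ.rot⁻¹ c) = c := τ.rot.apply_symm_apply c

theorem rot_inv_rot (c : BdryCorner T) : τ.rot⁻¹ (τ.rot c) = c := τ.rot.symm_apply_apply c

theorem opp_eq (c : BdryCorner T) : τ.opp c = τ.rot⁻¹ c.next := by
  rw [rot_inv_apply, opp]
  have h : (swap 1 2 * swap 1 3 * swap 2 3 : Perm (Fin 4)) = swap 1 3 := by decide
  have h3 := c.next_three
  rw [h3]
  refine Prod.ext rfl (Subtype.ext ?_)
  simp only [cross, BdryCorner.next, mul_assoc] at h ⊢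
  rw [h]

theorem rot_opp (c : BdryCorner T) : τ.rot (τ.opp c) = c.next := by
  rw [opp_eq, rot_rot_inv]

theorem opp_opp (c : BdryCorner T) : τ.opp (τ.opp c) = c :=
  τ.cross_cross _ _ _ _ _ _ _ (by
    simp only [opp, cross, Perm.mul_apply]; congr 2)

theorem opp_eq_next_next (c : BdryCorner T) : τ.opp c = (τ.rot c).next.next := by
  have h := τ.rot_opp (τ.opp c)
  rw [opp_opp] at h
  rw [h, BdryCorner.next_next_next]

theorem rev_rot (c : BdryCorner T) : (τ.rot c).rev = τ.rot⁻¹ c.rev := by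
  have h : (swap 2 3 * (swap 0 1 * swap 2 3) : Perm (Fin 4)) =
    swap 0 1 * swap 2 3 * swap 2 3 := by decide
  have h3 : c.rev.2.1 3 = c.2.1 2 := by
    simp only [BdryCorner.rev, Perm.mul_apply]; congr 1
  rw [rot_inv_apply, rot_apply, h3]
  refine Prod.ext rfl (Subtype.ext ?_)
  simp only [cross, BdryCorner.rev, mul_assoc] at h ⊢
  rw [h]

theorem vertex_eq_iff {c d : BdryCorner T} : τ.vertex c = τ.vertex d ↔ τ.rot.SameCycle c d :=
  Quotient.eq (r := SameCycle.setoid τ.rot)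

theorem vertex_rot (c : BdryCorner T) : τ.vertex (τ.rot c) = τ.vertex c :=
  τ.vertex_eq_iff.2 (sameCycle_apply_left.2 (SameCycle.refl _ _))

theorem vertex_rot_inv (c : BdryCorner T) : τ.vertex (τ.rot⁻¹ c) = τ.vertex c :=
  by
  rw [← vertex_rot, rot_rot_inv]

theorem vertex_opp (c : BdryCorner T) : τ.vertex (τ.opp c) = τ.vertex c.next := by
  rw [opp_eq, vertex_rot_inv]

end IdealTriangulation

namespace VeeringTriangulation

variable {T : Type*} (τ : VeeringTriangulation T)

/-- The coorientation of the side of the half-edge `c`: it is `true` if `c` is on the right of its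
vertex. -/
def side (c : BdryCorner T) : Bool := τ.out c.1 (c.2.1 2)

/-- The colour of the vertex at the corner `c`: it is `true` for red. -/
def col (c : BdryCorner T) : Bool := τ.red c.1 (c.2.1 0) (c.2.1 1)

theorem isRight_iff (c : BdryCorner T) : τ.IsRight c ↔ τ.side c = true := Iff.rfl

theorem col_rot (c : BdryCorner T) : τ.col (τ.rot c) = τ.col c := by
  have h := τ.red_glue c.1 (c.2.1 2) (c.2.1 0) (c.2.1 1) (by simp) (by simp)
  rw [col, col, ← h]
  rfl

theorem col_rot_inv (c : BdryCorner T) : τ.col (τ.rot⁻¹ c) = τ.col c := by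
  rw [← τ.col_rot (τ.rot⁻¹ c), τ.rot_rot_inv]

theorem col_opp (c : BdryCorner T) : τ.col (τ.opp c) = τ.col c.next := by
  rw [τ.opp_eq, col_rot_inv]

theorem col_rev (c : BdryCorner T) : τ.col c.rev = τ.col c := by
  have h0 : c.rev.2.1 0 = c.2.1 1 := by
    simp only [BdryCorner.rev, Perm.mul_apply]; congr 1
  have h1 : c.rev.2.1 1 = c.2.1 0 := by
    simp only [BdryCorner.rev, Perm.mul_apply]; congr 1
  rw [col, h0, h1, τ.red_symm]
  rfl

/-- The colour of a vertex of the boundary triangulation, i.e. of an edge of the triangulation. -/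
def vcol (v : τ.BdryVertex) : Bool :=
  Quotient.lift τ.col (fun c d h => by
    obtain ⟨k, rfl⟩ := h
    have : ∀ k : ℤ, τ.col ((τ.rot ^ k) c) = τ.col c := by
      intro k
      induction k with
      | zero => simp
      | succ k ih => rw [add_comm, zpow_add, zpow_one, Perm.mul_apply, col_rot, ih]
      | pred k ih =>
        rw [sub_eq_neg_add, zpow_add, zpow_neg_one, Perm.mul_apply, col_rot_inv, ih]
    exact (this k).symm) v

theorem vcol_vertex (c : BdryCorner T) : τ.vcol (τ.vertex c) = τ.col c := rfl

theorem col_eq_of_vertex_eq {c d : BdryCorner T} (h : τ.vertex c = τ.vertex d) :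
    τ.col c = τ.col d := by
  rw [← vcol_vertex, h, vcol_vertex]

theorem isPole_iff (c : BdryCorner T) : τ.IsPole c ↔ τ.col c = τ.col c.next := by
  rw [← col_opp]
  rfl

theorem isPole_opp (c : BdryCorner T) : τ.IsPole (τ.opp c) ↔ τ.IsPole c := by
  have h := τ.opp_opp c
  unfold IsPole
  rw [h]
  exact eq_comm

theorem side_opp (c : BdryCorner T) : τ.side (τ.opp c) = !τ.side c := by
  have h := τ.out_glue c.1 (c.2.1 2)
  rw [side, side, ← h]
  simp only [IdealTriangulation.opp, IdealTriangulation.cross, Perm.mul_apply]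
  congr 3

theorem side_rot_inv (c : BdryCorner T) : τ.side (τ.rot⁻¹ c) = !τ.side c.next.next := by
  rw [← side_opp, τ.opp_eq, c.next_next_next]

theorem side_next_next_rot (c : BdryCorner T) : τ.side (τ.rot c).next.next = !τ.side c := by
  rw [← τ.opp_eq_next_next, side_opp]

/-- The three sides of a triangle are not cooriented all alike, and the colours of its vertices
are determined, up to that of the vertex with the angle `π`, by the position of this angle. -/
theorem triangle_cases (c : BdryCorner T) :
    (τ.side c.next.next = τ.side c ∧ τ.side c.next = !τ.side c ∧
      τ.col c.next = false ∧ τ.col c.next.next = true) ∨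
    (τ.side c.next = τ.side c ∧ τ.side c.next.next = !τ.side c ∧
      τ.col c = true ∧ τ.col c.next.next = false) ∨
    (τ.side c.next = !τ.side c ∧ τ.side c.next.next = !τ.side c ∧
      τ.col c = false ∧ τ.col c.next = true) := by
  have key : ∀ c : BdryCorner T, τ.side c.next.next = τ.side c →
      τ.col c.next = false ∧ τ.col c.next.next = true := by
    intro c h
    have h2 : τ.side c.next.next = τ.out c.1 (c.2.1 3) := by
      rw [side, BdryCorner.next_two, BdryCorner.next_one]; rfl
    rw [h2] at h
    obtain ⟨h3, h4⟩ := τ.veer c h.symm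
    constructor
    · rw [col, c.next_zero, c.next_one]; exact h4
    · rw [col, BdryCorner.next_zero, BdryCorner.next_one, c.next_zero, c.next_three]; exact h3
  -- two of the four faces are cooriented outwards, so at least one and at most two of these three
  have hne : ¬ (τ.side c.next = τ.side c ∧ τ.side c.next.next = τ.side c) := by
    rintro ⟨h1, h2⟩
    have e1 : τ.side c.next = τ.out c.1 (c.2.1 1) := by
      rw [side, BdryCorner.next_two]; rfl
    have e2 : τ.side c.next.next = τ.out c.1 (c.2.1 3) := by
      rw [side, BdryCorner.next_two, BdryCorner.next_one]; rfl
    rw [e1] at h1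
    rw [e2] at h2
    have e0 : τ.side c = τ.out c.1 (c.2.1 2) := rfl
    have hc := τ.two_out c.1
    rw [Finset.card_filter, ← Equiv.sum_comp c.2.1, Fin.sum_univ_four, h1, h2, ← e0] at hc
    cases hs : τ.side c <;> cases h0 : τ.out c.1 (c.2.1 0) <;> simp [hs, h0] at hc
  have k0 := key c
  have k1 := key c.next
  have k2 := key c.next.next
  rw [c.next_next_next] at k1 k2
  revert hne k0 k1 k2
  generalize τ.side c = a
  generalize τ.side c.next = b
  generalize τ.side c.next.next = d
  generalize τ.col c = x
  generalize τ.col c.next = y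
  generalize τ.col c.next.next = z
  cases a <;> cases b <;> cases d <;> simp +contextual

end VeeringTriangulation

/-! ### The two fans at a vertex -/

namespace VeeringTriangulation

variable {T : Type*} (τ : VeeringTriangulation T)

/-- The number of branches in the fan of `v` on the side `b` (`true` for the right one). -/
def fanSize (b : Bool) (v : τ.BdryVertex) : ℕ :=
  Nat.card {c : BdryCorner T // τ.vertex c = v ∧ τ.side c = b}

/-- The position of a half-edge in its fan, counted counterclockwise from `0`. -/
def fanPos (c : BdryCorner T) : ℕ := sInf {k : ℕ | τ.side ((τ.rot⁻¹ ^ (k + 1)) c) ≠ τ.side c}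

theorem fanSize_true (v : τ.BdryVertex) : τ.fanSize true v = τ.rightSize v := rfl

theorem fanSize_false (v : τ.BdryVertex) : τ.fanSize false v = τ.leftSize v := by
  have : ∀ c, τ.side c = false ↔ ¬ τ.IsRight c := fun c => by simp [isRight_iff]
  simp only [fanSize, leftSize, this]

/-- Walking clockwise from a half-edge to one on the other side of the vertex, one meets the first
half-edge of a fan. -/
theorem exists_side_rot_inv_ne_of_pow (k : ℕ) (c : BdryCorner T)
    (h : τ.side ((τ.rot⁻¹ ^ k) c) ≠ τ.side c) :
    ∃ e, τ.vertex e = τ.vertex c ∧ τ.side e = τ.side c ∧ τ.side (τ.rot⁻¹ e) = !τ.side c := by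
  induction k generalizing c with
  | zero => simp at h
  | succ k ih =>
    by_cases hc : τ.side (τ.rot⁻¹ c) = τ.side c
    · rw [pow_succ, Perm.mul_apply, ← hc] at h
      obtain ⟨e, h1, h2, h3⟩ := ih _ h
      exact ⟨e, h1.trans (τ.vertex_rot_inv c), h2.trans hc, by rw [h3, hc]⟩
    · exact ⟨c, rfl, rfl, Bool.eq_not.2 hc⟩

/-- The angle at a corner is `π` if and only if the corner separates the two fans. -/
theorem out_eq_out_iff (c : BdryCorner T) :
    τ.out c.1 (c.2.1 2) = τ.out c.1 (c.2.1 3) ↔ τ.side (τ.rot⁻¹ c) ≠ τ.side c := by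
  have h2 : τ.side c.next.next = τ.out c.1 (c.2.1 3) := by
    rw [side, BdryCorner.next_two, BdryCorner.next_one]; rfl
  rw [side_rot_inv, h2, side]
  cases τ.out c.1 (c.2.1 2) <;> cases τ.out c.1 (c.2.1 3) <;> simp

theorem rightPos_eq {c : BdryCorner T} (h : τ.side c = true) : τ.rightPos c = τ.fanPos c := by
  simp only [rightPos, fanPos, h]
  rfl

variable [Finite T]

/-- Each fan has exactly one first half-edge: there are two angles `π` at each vertex. -/
theorem existsUnique_start (b : Bool) (v : τ.BdryVertex) :
    ∃! c, τ.vertex c = v ∧ τ.side c = b ∧ τ.side (τ.rot⁻¹ c) = !b := by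
  obtain ⟨c0, rfl⟩ : ∃ c, τ.vertex c = v := Quotient.exists_rep v
  set A : Set (BdryCorner T) := {d | τ.vertex d = τ.vertex c0 ∧ τ.side (τ.rot⁻¹ d) ≠ τ.side d}
    with hA
  have hcard : A.ncard = 2 := by
    rw [← τ.taut c0, ← Nat.card_coe_set_eq]
    refine Nat.card_congr (Equiv.subtypeEquivRight fun d => ?_)
    rw [out_eq_out_iff, ← τ.vertex_eq_iff, eq_comm (a := τ.vertex c0)]
    rfl
  obtain ⟨x, y, hxy, hAxy⟩ := Set.ncard_eq_two.1 hcard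
  have hx : x ∈ A := by rw [hAxy]; simp
  -- besides a change from one side to the other there is one in the opposite direction
  have hwalk : ∃ e ∈ A, τ.side e = !τ.side x := by
    have hs : τ.rot⁻¹.SameCycle (τ.rot⁻¹ x) x :=
      sameCycle_apply_left.2 (SameCycle.refl _ _)
    obtain ⟨k, -, -, hk⟩ := hs.exists_pow_eq''
    have hx2 : τ.side (τ.rot⁻¹ x) = !τ.side x := Bool.eq_not.2 hx.2
    obtain ⟨e, h1, h2, h3⟩ := τ.exists_side_rot_inv_ne_of_pow k (τ.rot⁻¹ x)
      (by rw [hk]; exact hx.2.symm)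
    refine ⟨e, ⟨h1.trans ((τ.vertex_rot_inv x).trans hx.1), ?_⟩, h2.trans hx2⟩
    rw [h2, h3]
    simp
  obtain ⟨e, he, hex⟩ := hwalk
  have hey : e = y := by
    have : e ∈ ({x, y} : Set (BdryCorner T)) := hAxy ▸ he
    rcases this with h | h
    · subst h; simp at hex
    · exact h
  subst hey
  have huniq : ∀ d, τ.vertex d = τ.vertex c0 → τ.side (τ.rot⁻¹ d) ≠ τ.side d → d = x ∨ d = e := by
    intro d h1 h2
    have : d ∈ ({x, e} : Set (BdryCorner T)) := hAxy ▸ (⟨h1, h2⟩ : d ∈ A)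
    exact this
  by_cases hb : τ.side x = b
  · refine ⟨x, ⟨hx.1, hb, by have := hx.2; rw [hb] at this; exact Bool.eq_not.2 this⟩, ?_⟩
    rintro d ⟨h1, h2, h3⟩
    rcases huniq d h1 (by rw [h2, h3]; simp) with h | h
    · exact h
    · rw [h, hex, hb] at h2; simp at h2
  · have hb' : τ.side e = b := by rw [hex]; cases b <;> simpa using hb
    refine ⟨e, ⟨he.1, hb', by have := he.2; rw [hb'] at this; exact Bool.eq_not.2 this⟩, ?_⟩
    rintro d ⟨h1, h2, h3⟩
    rcases huniq d h1 (by rw [h2, h3]; simp) with h | h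
    · rw [h] at h2; exact absurd h2 hb
    · exact h

theorem exists_side_pow_ne (c : BdryCorner T) :
    ∃ k : ℕ, τ.side ((τ.rot⁻¹ ^ (k + 1)) c) ≠ τ.side c := by
  obtain ⟨d, ⟨h1, h2, -⟩, -⟩ := τ.existsUnique_start (!τ.side c) (τ.vertex c)
  have hs : τ.rot⁻¹.SameCycle c d := sameCycle_inv.2 (τ.vertex_eq_iff.1 h1.symm)
  obtain ⟨k, hk, -, hk'⟩ := hs.exists_pow_eq''
  refine ⟨k - 1, ?_⟩
  rw [Nat.sub_add_cancel hk, hk', h2]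
  simp

theorem fanPos_spec (c : BdryCorner T) :
    τ.side ((τ.rot⁻¹ ^ (τ.fanPos c + 1)) c) ≠ τ.side c :=
  Nat.sInf_mem (s := {k : ℕ | τ.side ((τ.rot⁻¹ ^ (k + 1)) c) ≠ τ.side c}) (τ.exists_side_pow_ne c)

theorem fanPos_eq_zero_iff (c : BdryCorner T) :
    τ.fanPos c = 0 ↔ τ.side (τ.rot⁻¹ c) = !τ.side c := by
  constructor
  · intro h
    have := τ.fanPos_spec c
    rw [h, zero_add, pow_one] at this
    exact Bool.eq_not.2 this
  · intro h
    refine Nat.le_zero.1 (Nat.sInf_le ?_)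
    rw [Set.mem_ofPred_eq, zero_add, pow_one]
    exact Bool.eq_not.1 h

theorem fanPos_eq_succ (c : BdryCorner T) (h : τ.side (τ.rot⁻¹ c) = τ.side c) :
    τ.fanPos c = τ.fanPos (τ.rot⁻¹ c) + 1 := by
  have e : ∀ k, (τ.rot⁻¹ ^ (k + 1)) (τ.rot⁻¹ c) = (τ.rot⁻¹ ^ (k + 1 + 1)) c := fun k => by
    rw [pow_succ _ (k + 1), Perm.mul_apply]
  apply le_antisymm
  · have h1 := τ.fanPos_spec (τ.rot⁻¹ c)
    rw [e, h] at h1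
    exact Nat.sInf_le h1
  · have h1 := τ.fanPos_spec c
    obtain ⟨k, hk⟩ : ∃ k, τ.fanPos c = k + 1 := by
      refine Nat.exists_eq_succ_of_ne_zero fun h0 => ?_
      rw [fanPos_eq_zero_iff, h] at h0
      simp at h0
    rw [hk] at h1 ⊢
    rw [← e, ← h] at h1
    exact Nat.succ_le_succ (Nat.sInf_le h1)

theorem fanPos_rot (c : BdryCorner T) (h : τ.side (τ.rot c) = τ.side c) :
    τ.fanPos (τ.rot c) = τ.fanPos c + 1 := by
  rw [τ.fanPos_eq_succ _ (by rw [τ.rot_inv_rot, h]), τ.rot_inv_rot]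

theorem fanPos_injective {c d : BdryCorner T} (hv : τ.vertex c = τ.vertex d)
    (hs : τ.side c = τ.side d) (h : τ.fanPos c = τ.fanPos d) : c = d := by
  induction hk : τ.fanPos c generalizing c d with
  | zero =>
    rw [hk] at h
    refine (τ.existsUnique_start (τ.side c) (τ.vertex c)).unique
      ⟨rfl, rfl, (τ.fanPos_eq_zero_iff c).1 hk⟩ ⟨hv.symm, hs.symm, ?_⟩
    rw [(τ.fanPos_eq_zero_iff d).1 h.symm, hs]
  | succ k ih =>
    have key : ∀ c : BdryCorner T, τ.fanPos c = k + 1 → τ.side (τ.rot⁻¹ c) = τ.side c := by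
      intro c hc
      by_contra hne
      rw [(τ.fanPos_eq_zero_iff c).2 (Bool.eq_not.2 hne)] at hc
      omega
    have hc := key c hk
    have hd := key d (h ▸ hk)
    have h1 := τ.fanPos_eq_succ c hc
    have h2 := τ.fanPos_eq_succ d hd
    have := ih (c := τ.rot⁻¹ c) (d := τ.rot⁻¹ d) (by rw [τ.vertex_rot_inv, τ.vertex_rot_inv, hv])
      (by rw [hc, hd, hs]) (by omega) (by omega)
    exact τ.rot⁻¹.injective this

/-- A fan of size `n` has its branches at the positions `0, …, n - 1`. -/
theorem exists_fanPos_eq_iff (b : Bool) (v : τ.BdryVertex) (k : ℕ) :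
    (∃ c, τ.vertex c = v ∧ τ.side c = b ∧ τ.fanPos c = k) ↔ k < τ.fanSize b v := by
  set S : Set ℕ := {k | ∃ c, τ.vertex c = v ∧ τ.side c = b ∧ τ.fanPos c = k} with hS
  have hcard : S.ncard = τ.fanSize b v := by
    rw [fanSize, ← Nat.card_coe_set_eq]
    symm
    refine Nat.card_eq_of_bijective
      (fun c => (⟨τ.fanPos c.1, c.1, c.2.1, c.2.2, rfl⟩ : S)) ⟨?_, ?_⟩
    · rintro ⟨c, hc⟩ ⟨d, hd⟩ h
      exact Subtype.ext (τ.fanPos_injective (hc.1.trans hd.1.symm) (hc.2.trans hd.2.symm)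
        (congrArg Subtype.val h))
    · rintro ⟨k, c, h1, h2, rfl⟩
      exact ⟨⟨c, h1, h2⟩, rfl⟩
  -- the set of positions is a lower set with as many elements as the fan
  have hdown : ∀ k, k + 1 ∈ S → k ∈ S := by
    rintro k ⟨c, h1, h2, h3⟩
    have hc : τ.side (τ.rot⁻¹ c) = τ.side c := by
      by_contra hne
      rw [(τ.fanPos_eq_zero_iff c).2 (Bool.eq_not.2 hne)] at h3
      omega
    have := τ.fanPos_eq_succ c hc
    exact ⟨τ.rot⁻¹ c, by rw [τ.vertex_rot_inv, h1], by rw [hc, h2], by omega⟩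
  have hlow : ∀ k j, j ≤ k → k ∈ S → j ∈ S := by
    intro k j hjk
    induction k, hjk using Nat.le_induction with
    | base => exact id
    | succ k _ ih => exact fun h => ih (hdown k h)
  have hfin : S.Finite := by
    have : Finite {c : BdryCorner T // τ.vertex c = v ∧ τ.side c = b} := inferInstance
    refine Set.Finite.subset (Set.finite_range τ.fanPos) ?_
    rintro k ⟨c, -, -, rfl⟩
    exact ⟨c, rfl⟩
  change k ∈ S ↔ _
  rw [← hcard]
  constructor
  · intro hk
    have : Set.Iio (k + 1) ⊆ S := fun j hj => hlow k j (Nat.lt_succ_iff.1 hj) hk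
    have h2 := Set.ncard_le_ncard this hfin
    rw [← Finset.coe_Iio, Set.ncard_coe_finset, Nat.card_Iio] at h2
    omega
  · intro hk
    by_contra hn
    have : S ⊆ Set.Iio k := fun j hj => by
      by_contra hjk
      exact hn (hlow j k (not_lt.1 hjk) hj)
    have h2 := Set.ncard_le_ncard this (Set.finite_Iio k)
    rw [← Finset.coe_Iio, Set.ncard_coe_finset, Nat.card_Iio] at h2
    omega

theorem fanPos_lt (c : BdryCorner T) : τ.fanPos c < τ.fanSize (τ.side c) (τ.vertex c) :=
  (τ.exists_fanPos_eq_iff _ _ _).1 ⟨c, rfl, rfl, rfl⟩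

theorem side_rot_eq_iff (c : BdryCorner T) :
    τ.side (τ.rot c) = τ.side c ↔ τ.fanPos c + 1 < τ.fanSize (τ.side c) (τ.vertex c) := by
  constructor
  · intro h
    have := τ.fanPos_lt (τ.rot c)
    rwa [τ.fanPos_rot c h, h, τ.vertex_rot] at this
  · intro h
    obtain ⟨d, h1, h2, h3⟩ := (τ.exists_fanPos_eq_iff _ _ _).2 h
    have hd : τ.side (τ.rot⁻¹ d) = τ.side d := by
      by_contra hne
      rw [(τ.fanPos_eq_zero_iff d).2 (Bool.eq_not.2 hne)] at h3
      omega
    have h4 := τ.fanPos_eq_succ d hd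
    have : τ.rot⁻¹ d = c := τ.fanPos_injective (by rw [τ.vertex_rot_inv, h1]) (by rw [hd, h2])
      (by omega)
    rw [← this, τ.rot_rot_inv, hd]

/-- On the left of a vertex the positions from below run against the counterclockwise ones. -/
theorem leftPos_add_fanPos {c : BdryCorner T} (h : τ.side c = false) :
    τ.leftPos c + τ.fanPos c + 1 = τ.fanSize false (τ.vertex c) := by
  have hlt := τ.fanPos_lt c
  rw [h] at hlt
  obtain ⟨k, hk⟩ : ∃ k, τ.fanPos c + 1 + k = τ.fanSize false (τ.vertex c) :=
    ⟨_, Nat.add_sub_of_le hlt⟩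
  suffices τ.leftPos c = k by omega
  clear hlt
  induction k generalizing c with
  | zero =>
    have : ¬ τ.side (τ.rot c) = τ.side c := by rw [side_rot_eq_iff, h]; omega
    rw [h] at this
    refine Nat.le_zero.1 (Nat.sInf_le ?_)
    simpa [isRight_iff] using this
  | succ k ih =>
    have hr : τ.side (τ.rot c) = τ.side c := by rw [side_rot_eq_iff, h]; omega
    have h1 := ih (c := τ.rot c) (hr.trans h)
      (by rw [τ.fanPos_rot c hr, τ.vertex_rot]; omega)
    have e : ∀ k, (τ.rot ^ (k + 1)) (τ.rot c) = (τ.rot ^ (k + 1 + 1)) c := fun k => by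
      rw [pow_succ _ (k + 1), Perm.mul_apply]
    have hex : ∃ k : ℕ, τ.IsRight ((τ.rot ^ (k + 1)) c) := by
      obtain ⟨d, ⟨h1, h2, -⟩, -⟩ := τ.existsUnique_start true (τ.vertex c)
      obtain ⟨k, hk, -, hk'⟩ := (τ.vertex_eq_iff.1 h1.symm).exists_pow_eq''
      exact ⟨k - 1, by rw [Nat.sub_add_cancel hk, hk']; exact h2⟩
    have hspec : τ.IsRight ((τ.rot ^ (τ.leftPos c + 1)) c) :=
      Nat.sInf_mem (s := {k : ℕ | τ.IsRight ((τ.rot ^ (k + 1)) c)}) hex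
    obtain ⟨j, hj⟩ : ∃ j, τ.leftPos c = j + 1 := by
      refine Nat.exists_eq_succ_of_ne_zero fun h0 => ?_
      rw [h0, zero_add, pow_one, isRight_iff, hr, h] at hspec
      simp at hspec
    have hspec' : τ.IsRight ((τ.rot ^ (τ.leftPos (τ.rot c) + 1)) (τ.rot c)) := by
      refine Nat.sInf_mem (s := {k : ℕ | τ.IsRight ((τ.rot ^ (k + 1)) (τ.rot c))}) ?_
      refine ⟨j, ?_⟩
      change τ.IsRight _
      rw [e, ← hj]
      exact hspec
    rw [e, h1] at hspec'
    rw [hj, ← e] at hspec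
    have l1 : τ.leftPos c ≤ k + 1 := Nat.sInf_le hspec'
    have l2 : τ.leftPos (τ.rot c) ≤ j := Nat.sInf_le hspec
    omega

end VeeringTriangulation

/-! ### Bi-infinite sequences and lifts of cycles -/

/-- A relation that is total in both directions has a bi-infinite orbit. -/
theorem exists_int_seq {X : Type*} (r : ℤ → X → X → Prop) (hf : ∀ n x, ∃ y, r n x y)
    (hb : ∀ n y, ∃ x, r n x y) (x₀ : X) :
    ∃ u : ℤ → X, u 0 = x₀ ∧ ∀ n, r n (u n) (u (n + 1)) := by
  choose F hF using hf
  choose B hB using hb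
  let p : ℕ → X := fun n => Nat.rec x₀ (fun k x => F k x) n
  let q : ℕ → X := fun n => Nat.rec (B (-1) x₀) (fun k x => B (-(k + 2 : ℤ)) x) n
  let u : ℤ → X := fun n => Int.casesOn n p q
  refine ⟨u, rfl, fun n => ?_⟩
  cases n with
  | ofNat k => exact hF k (p k)
  | negSucc k =>
    cases k with
    | zero => exact hB (-1) x₀
    | succ k =>
      have h1 : Int.negSucc (k + 1) + 1 = Int.negSucc k := by omega
      have h2 : Int.negSucc (k + 1) = -(k + 2 : ℤ) := by omega
      rw [h1]
      change r (Int.negSucc (k + 1)) (B (-(k + 2 : ℤ)) (q k)) (q k)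
      rw [h2]
      exact hB _ _

theorem exists_int_sum {A : Type*} [AddCommGroup A] (g : ℤ → A) (x₀ : A) :
    ∃ u : ℤ → A, u 0 = x₀ ∧ ∀ n, u (n + 1) = u n + g n :=
  exists_int_seq (fun n x y => y = x + g n) (fun n x => ⟨x + g n, rfl⟩)
    (fun n y => ⟨y - g n, by simp⟩) x₀

/-- The lift of the permutation `σ` of `X` to `X × ℤ` by the cocycle `w`. -/
def Equiv.Perm.skewProduct {X : Type*} (σ : Perm X) (w : X → ℤ) : Perm (X × ℤ) where
  toFun p := (σ p.1, p.2 + w p.1)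
  invFun p := (σ.symm p.1, p.2 - w (σ.symm p.1))
  left_inv p := by simp
  right_inv p := by simp

theorem Equiv.Perm.skewProduct_pow_apply {X : Type*} (σ : Perm X) (w : X → ℤ) (k : ℕ) (x : X)
    (W : ℤ) : ((σ.skewProduct w) ^ k) (x, W) =
      ((σ ^ k) x, W + ∑ i ∈ Finset.range k, w ((σ ^ i) x)) := by
  induction k with
  | zero => simp
  | succ k ih =>
    rw [pow_succ', Perm.mul_apply, ih, Finset.sum_range_succ, pow_succ', Perm.mul_apply,
      ← add_assoc]
    rfl

theorem Equiv.Perm.skewProduct_zpow_apply_fst {X : Type*} (σ : Perm X) (w : X → ℤ) (k : ℤ)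
    (p : X × ℤ) : (((σ.skewProduct w) ^ k) p).1 = (σ ^ k) p.1 := by
  induction k generalizing p with
  | zero => simp
  | succ k ih => rw [zpow_add_one, Perm.mul_apply, ih, zpow_add_one, Perm.mul_apply]; rfl
  | pred k ih => rw [zpow_sub_one, Perm.mul_apply, ih, zpow_sub_one, Perm.mul_apply]; rfl

/-- If the cocycle `w` adds up to `±1` over a cycle `s` of `σ`, then the lift of `σ` by `w` acts on
`s × ℤ` simply transitively, so that the points of `s × ℤ` are indexed by the integers. -/
theorem exists_lift_index {X : Type*} (σ : Perm X) (s : Finset X) (hσ : σ.IsCycleOn s)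
    (hne : s.Nonempty) (w : X → ℤ) (ε : ℤ) (hε : ε * ε = 1) (hw : ∑ x ∈ s, w x = ε) :
    ∃ (a : ℤ → X) (J : X → ℤ → ℤ), (∀ j, a j ∈ s) ∧ (∀ j, a (j + 1) = σ (a j)) ∧
      (∀ j, a (j + s.card) = a j) ∧ (∀ x ∈ s, ∀ W, a (J x W) = x) ∧
      (∀ x ∈ s, ∀ W, J (σ x) (W + w x) = J x W + 1) ∧
      (∀ x ∈ s, ∀ W, J x (W + 1) = J x W + ε * s.card) ∧
      (∀ j, ∃ W, J (a j) W = j) := by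
  classical
  obtain ⟨x₀, hx₀⟩ := hne
  set S := σ.skewProduct w with hS
  have hmem : ∀ (j : ℤ) x, x ∈ s → (σ ^ j) x ∈ s := fun j x hx =>
    (hσ.1.perm_zpow j).mapsTo hx
  -- the lift of one full period of the cycle is the translation by `ε`
  have hshift : ∀ x ∈ s, ∀ W, (S ^ s.card) (x, W) = (x, W + ε) := by
    intro x hx W
    rw [hS, Equiv.Perm.skewProduct_pow_apply, hσ.pow_card_apply hx, ← hw]
    congr 2
    refine Finset.sum_nbij (fun i => (σ ^ i) x) ?_ ?_ ?_ (fun _ _ => rfl)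
    · intro i _
      exact hmem i x hx
    · intro i hi j hj hij
      have := (hσ.pow_apply_eq_pow_apply hx).1 hij
      rw [Finset.coe_range] at hi hj
      exact Nat.ModEq.eq_of_lt_of_lt this hi hj
    · intro y hy
      obtain ⟨n, hn, h⟩ := hσ.exists_pow_eq hx hy
      exact ⟨n, by simpa using hn, h⟩
  have hshiftz : ∀ x ∈ s, ∀ W t : ℤ, (S ^ ((s.card : ℤ) * t)) (x, W) = (x, W + t * ε) := by
    intro x hx W t
    rw [zpow_mul, zpow_natCast]
    induction t with
    | zero => simp
    | succ t ih =>
      rw [add_comm, zpow_add, zpow_one, Perm.mul_apply, ih, hshift x hx]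
      congr 1
      ring
    | pred t ih =>
      have h2 : (S ^ s.card) ((x, W + (-t - 1) * ε) : X × ℤ) = (x, W + -t * ε) := by
        rw [hshift x hx]; congr 1; ring
      apply (S ^ s.card).injective
      rw [h2, ← ih, ← Perm.mul_apply, ← zpow_one_add]
      congr 2
      ring
  set o : ℤ → X × ℤ := fun j => (S ^ j) (x₀, 0) with ho
  have ho1 : ∀ j, (o j).1 = (σ ^ j) x₀ := fun j => σ.skewProduct_zpow_apply_fst w j _
  have hos : ∀ j, o (j + 1) = S (o j) := fun j => by
    simp only [ho]
    rw [add_comm, zpow_add, zpow_one, Perm.mul_apply]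
  have hoS : ∀ j, (o j).1 ∈ s := fun j => by rw [ho1]; exact hmem j _ hx₀
  have hoV : ∀ j t : ℤ, o (j + s.card * t) = ((o j).1, (o j).2 + t * ε) := fun j t => by
    simp only [ho]
    rw [add_comm, zpow_add, Perm.mul_apply]
    exact hshiftz _ (hoS j) _ _
  have hsurj : ∀ x W, ∃ j, x ∈ s → o j = (x, W) := by
    intro x W
    by_cases hx : x ∈ s
    · obtain ⟨i, -, hi⟩ := hσ.exists_pow_eq hx₀ hx
      refine ⟨i + s.card * (ε * (W - (o i).2)), fun _ => ?_⟩
      rw [hoV]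
      refine Prod.ext ?_ ?_
      · rw [ho1, zpow_natCast, hi]
      · change (o i).2 + ε * (W - (o i).2) * ε = W
        linear_combination (W - (o i).2) * hε
    · exact ⟨0, fun h => absurd h hx⟩
  have hinj : ∀ i j, o i = o j → i = j := by
    intro i j h
    have h1 : (σ ^ i) x₀ = (σ ^ j) x₀ := by rw [← ho1, ← ho1, h]
    rw [hσ.zpow_apply_eq_zpow_apply hx₀, Int.modEq_iff_dvd] at h1
    obtain ⟨t, ht⟩ := h1
    have h2 := hoV i t
    rw [← ht, add_sub_cancel, ← h] at h2
    have h3 := congrArg Prod.snd h2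
    simp only at h3
    have h4 : t * ε = 0 := by linarith
    have h5 : t = 0 := by
      have : t * (ε * ε) = 0 := by rw [← mul_assoc, h4, zero_mul]
      rwa [hε, mul_one] at this
    rw [h5] at ht
    linarith
  choose J hJ using hsurj
  refine ⟨fun j => (o j).1, J, fun j => ?_, fun j => ?_, fun j => ?_, fun x hx W => ?_,
    fun x hx W => ?_, fun x hx W => ?_, fun j => ⟨(o j).2, ?_⟩⟩
  · exact hoS j
  · change (o (j + 1)).1 = σ (o j).1
    rw [hos]; rfl
  · change (o (j + s.card)).1 = (o j).1
    have := hoV j 1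
    rw [mul_one] at this
    rw [this]
  · change (o (J x W)).1 = x
    rw [hJ x W hx]
  · apply hinj
    rw [hJ _ _ (hσ.apply_mem_iff.2 hx), hos, hJ x W hx]; rfl
  · apply hinj
    have h1 := hoV (J x W) ε
    rw [hJ x W hx] at h1
    rw [hJ _ _ hx, mul_comm, h1]
    change _ = (x, W + ε * ε)
    rw [hε]
  · apply hinj
    rw [hJ _ _ (hoS j)]

/-! ### Crossing a ladderpole -/

/-- The foliation near a lifted ladderpole, drawn so that the pole goes up from left to right.
The vertices of the pole are numbered by `ℤ`, and the numbering has period `V`. The vertex `j` has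
`n j` strips on its left, the lowest of which is the pole, and `m j` strips on its right, the
highest of which is the pole; `f j` glues the two fans. All rungs on the left of the pole are
numbered from below, and those at the vertex `j` have the numbers `L j, …, L (j + 1) - 1`; likewise
with `R` on the right. By `dual`, each gluing map occurs once more, inverted, within a period. -/
structure PoleModel where
  V : ℕ
  n : ℤ → ℕ
  m : ℤ → ℕ
  f : ℤ → ℝ → ℝ
  L : ℤ → ℤ
  R : ℤ → ℤ
  two_le_n : ∀ j, 2 ≤ n j
  two_le_m : ∀ j, 2 ≤ m j
  f_mono : ∀ j, StrictMonoOn (f j) (Icc 0 (n j))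
  f_zero : ∀ j, f j 0 = 0
  f_top : ∀ j, f j (n j) = m j
  L_succ : ∀ j, L (j + 1) = L j + n j - 1
  R_succ : ∀ j, R (j + 1) = R j + m j - 1
  n_period : ∀ j, n (j + V) = n j
  m_period : ∀ j, m (j + V) = m j
  f_period : ∀ j, f (j + V) = f j
  dual : ∀ j : ℤ, ∃ j' : ℤ, j < j' ∧ j' < j + V ∧ n j' = m j ∧ m j' = n j ∧
    ∀ x ∈ Icc (0 : ℝ) (n j), f j' (f j x) = x

theorem eq_apply_zero_of_forall_succ_eq {A : Type*} (g : ℤ → A) (h : ∀ j, g (j + 1) = g j) (j : ℤ) :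
    g j = g 0 := by
  induction j with
  | zero => rfl
  | succ k ih => rw [h, ih]
  | pred k ih => rw [← ih, ← h (-k - 1), sub_add_cancel]

namespace PoleModel

variable (P : PoleModel)

theorem L_period (j : ℤ) : P.L (j + P.V) = P.L j + (P.L P.V - P.L 0) := by
  have := eq_apply_zero_of_forall_succ_eq (fun j => P.L (j + P.V) - P.L j) (fun j => by
    have h1 := P.L_succ (j + P.V)
    have h2 := P.L_succ j
    rw [P.n_period] at h1
    rw [add_right_comm]
    linarith) j
  simp only [zero_add] at this
  linarith

theorem R_period (j : ℤ) : P.R (j + P.V) = P.R j + (P.R P.V - P.R 0) := by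
  have := eq_apply_zero_of_forall_succ_eq (fun j => P.R (j + P.V) - P.R j) (fun j => by
    have h1 := P.R_succ (j + P.V)
    have h2 := P.R_succ j
    rw [P.m_period] at h1
    rw [add_right_comm]
    linarith) j
  simp only [zero_add] at this
  linarith

theorem L_strictMono : StrictMono P.L := strictMono_int_of_lt_succ fun j => by
  have h1 := P.L_succ j
  have h2 := P.two_le_n j
  omega

theorem R_strictMono : StrictMono P.R := strictMono_int_of_lt_succ fun j => by
  have h1 := P.R_succ j
  have h2 := P.two_le_m j
  omega

theorem L_succ_real (j : ℤ) : (P.L (j + 1) : ℝ) = P.L j + P.n j - 1 := by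
  have := P.L_succ j
  exact_mod_cast this

theorem R_succ_real (j : ℤ) : (P.R (j + 1) : ℝ) = P.R j + P.m j - 1 := by
  have := P.R_succ j
  exact_mod_cast this

theorem two_le_n_real (j : ℤ) : (2 : ℝ) ≤ P.n j := by exact_mod_cast P.two_le_n j

theorem two_le_m_real (j : ℤ) : (2 : ℝ) ≤ P.m j := by exact_mod_cast P.two_le_m j

theorem f_le_f {j : ℤ} {x y : ℝ} (hx : 0 ≤ x) (hxy : x ≤ y) (hy : y ≤ P.n j) :
    P.f j x ≤ P.f j y :=
  (P.f_mono j).monotoneOn ⟨hx, hxy.trans hy⟩ ⟨hx.trans hxy, hy⟩ hxy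

theorem f_nonneg {j : ℤ} {x : ℝ} (hx : 0 ≤ x) (hx' : x ≤ P.n j) : 0 ≤ P.f j x := by
  rw [← P.f_zero j]
  exact P.f_le_f le_rfl hx hx'

theorem f_le {j : ℤ} {x : ℝ} (hx : 0 ≤ x) (hx' : x ≤ P.n j) : P.f j x ≤ P.m j := by
  rw [← P.f_top j]
  exact P.f_le_f hx hx' le_rfl

/-- A leaf cannot follow the pole through `V` consecutive vertices. On its way it would pass both a
vertex and the dual vertex. The leaf enters the former on the lowest strip on the left and leaves
it on the highest strip on the right, and then it can do the same at the dual vertex only if both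
fans have exactly two strips and the leaf passes the former vertex on the common boundary of the
strips. But then it leaves the pole at the next vertex. -/
theorem not_follows_pole (j : ℤ) (z : ℕ → ℝ) (hz : ∀ i < P.V, 0 ≤ z i ∧ z i ≤ 1)
    (h : ∀ i < P.V, (P.m (j + i) : ℝ) - 1 ≤ P.f (j + i) (z i) ∧
      z (i + 1) = P.f (j + i) (z i) - (P.m (j + i) - 1)) : False := by
  obtain ⟨j', h1, h2, hn, hm, hf⟩ := P.dual j
  obtain ⟨d, rfl⟩ : ∃ d : ℕ, j' = j + d := ⟨(j' - j).toNat, by omega⟩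
  have hd : d < P.V := by omega
  have hd0 : 0 < d := by omega
  have hV1 : 1 < P.V := by omega
  obtain ⟨a1, a2⟩ := h 0 (by omega)
  have a3 := hz 0 (by omega)
  simp only [Nat.cast_zero, add_zero, zero_add] at a1 a2
  obtain ⟨b1, -⟩ := h d hd
  have b3 := hz d hd
  have c1 := P.two_le_n_real j
  have c2 := P.two_le_m_real j
  have hx : (P.n j : ℝ) - 1 ∈ Icc (0 : ℝ) (P.n j) := ⟨by linarith, by linarith⟩
  -- the dual vertex is passed from a height in `[0, 1]` to a height of at least `n j - 1`
  have e1 : P.f j (P.n j - 1) ≤ z d := by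
    by_contra hlt
    rw [not_le] at hlt
    have hn' : (P.n (j + d) : ℝ) = P.m j := by rw [hn]
    have h5 := P.f_mono (j + d) (a := z d) (b := P.f j (P.n j - 1))
      ⟨b3.1, by linarith [b3.2, hn']⟩
      ⟨P.f_nonneg hx.1 hx.2, by rw [hn']; exact P.f_le hx.1 hx.2⟩ hlt
    rw [hf _ hx] at h5
    rw [hm] at b1
    linarith
  have e2 : P.f j (z 0) ≤ P.f j (P.n j - 1) := P.f_le_f a3.1 (by linarith) hx.2
  -- all inequalities between `1` and `m j - 1` are equalities, so the leaf arrives at the height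
  -- `0` at the next vertex, and it stays at this height
  have e3 : z 1 = 0 := by linarith
  obtain ⟨d1, -⟩ := h 1 hV1
  rw [e3, P.f_zero] at d1
  have := P.two_le_m_real (j + (1 : ℕ))
  linarith

/-- `P.Cross j z y`: the leaf through the point at the height `z` of the left fan of the vertex `j`
follows the pole for a while and leaves it on the right at the coordinate `y`. -/
inductive Cross : ℤ → ℝ → ℝ → Prop
  | exit {j : ℤ} {z : ℝ} (h : P.f j z ≤ P.m j - 1) : Cross j z (P.R j + P.f j z)
  | pass {j : ℤ} {z z' y : ℝ} (h : P.f j z = P.m j - 1 + z') (h0 : 0 ≤ z') (h1 : z' ≤ 1)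
      (hc : Cross (j + 1) z' y) : Cross j z y

variable {P}

theorem Cross.le {j : ℤ} {z y : ℝ} (h : P.Cross j z y) (h0 : 0 ≤ z) (h1 : z ≤ P.n j) :
    P.R j ≤ y := by
  induction h with
  | exit h => linarith [P.f_nonneg h0 h1]
  | @pass j z w y h hw0 hw1 hc ih =>
    have a := P.R_succ_real j
    have b := P.two_le_m_real j
    have c := P.two_le_n_real (j + 1)
    linarith [ih hw0 (by linarith)]

theorem Cross.eq_of_zero {j : ℤ} {y : ℝ} (h : P.Cross j 0 y) : y = P.R j := by
  cases h with
  | exit h => rw [P.f_zero, add_zero]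
  | pass h h0 h1 hc =>
    rw [P.f_zero] at h
    linarith [P.two_le_m_real j]

/-- Leaves through the same vertex do not cross. -/
theorem Cross.mono {j : ℤ} {z z' y y' : ℝ} (h : P.Cross j z y) (h' : P.Cross j z' y')
    (h0 : 0 ≤ z) (hz : z ≤ z') (h1 : z' ≤ P.n j) : y ≤ y' := by
  induction h generalizing z' y' with
  | @exit j z h =>
    cases h' with
    | exit h' => linarith [P.f_le_f h0 hz h1]
    | pass h' h0' h1' hc =>
      have a := P.R_succ_real j
      have c := P.two_le_n_real (j + 1)
      linarith [hc.le h0' (by linarith)]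
  | @pass j z w y h hw0 hw1 hc ih =>
    have hm := P.f_le_f h0 hz h1
    cases h' with
    | exit h' =>
      -- both leaves pass through the boundary of the pole and the highest rung on the right
      have hw : w = 0 := by linarith
      subst hw
      rw [hc.eq_of_zero, P.R_succ_real]
      linarith
    | pass h' h0' h1' hc' =>
      have c := P.two_le_n_real (j + 1)
      exact ih hc' hw0 (by linarith) (by linarith)

/-- A leaf that meets the pole at a lower vertex leaves it below. -/
theorem Cross.le_of_lt {j j' : ℤ} {z z' y y' : ℝ} (h : P.Cross j z y) (h' : P.Cross j' z' y')
    (hj : j < j') (h1 : 1 ≤ z') (h2 : z' ≤ P.n j') : y ≤ y' := by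
  induction h with
  | @exit j z h =>
    have a : (P.R (j + 1) : ℝ) ≤ P.R j' := by exact_mod_cast P.R_strictMono.monotone hj
    have b := P.R_succ_real j
    linarith [h'.le (by linarith) h2]
  | @pass j z w y h hw0 hw1 hc ih =>
    rcases (Int.add_one_le_iff.2 hj).lt_or_eq with hlt | rfl
    · exact ih hlt
    · exact hc.mono h' hw0 (by linarith) h2

theorem Cross.period {j : ℤ} {z y : ℝ} (h : P.Cross j z y) :
    P.Cross (j + P.V) z (y + (P.R P.V - P.R 0 : ℤ)) := by
  induction h with
  | @exit j z h =>
    have h2 : P.f (j + P.V) z ≤ P.m (j + P.V) - 1 := by rwa [P.f_period, P.m_period]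
    have h3 := Cross.exit (P := P) h2
    rw [P.R_period, P.f_period] at h3
    rwa [add_right_comm, ← Int.cast_add]
  | @pass j z w y h hw0 hw1 hc ih =>
    refine Cross.pass (z' := w) ?_ hw0 hw1 ?_
    · rw [P.f_period, P.m_period, h]
    · rwa [add_right_comm]

variable (P)

/-- Each leaf leaves the pole. -/
theorem exists_cross (j : ℤ) (z : ℝ) (h0 : 0 ≤ z) (h1 : z ≤ P.n j) : ∃ y, P.Cross j z y := by
  have step : ∀ d : ℕ, ∀ (j : ℤ) (z : ℝ), 0 ≤ z → z ≤ P.n j → (∃ y, P.Cross j z y) ∨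
      ∃ u : ℕ → ℝ, u 0 = z ∧ (∀ i < d, 0 ≤ u (i + 1) ∧ u (i + 1) ≤ 1) ∧
        ∀ i < d, u (i + 1) = P.f (j + i) (u i) - (P.m (j + i) - 1) := by
    intro d
    induction d with
    | zero => exact fun j z _ _ => Or.inr ⟨fun _ => z, rfl, by simp, by simp⟩
    | succ d ih =>
      intro j z h0 h1
      rcases le_or_gt (P.f j z) (P.m j - 1) with h | h
      · exact Or.inl ⟨_, Cross.exit h⟩
      · have hle := P.f_le h0 h1
        have a1 : 0 ≤ P.f j z - (P.m j - 1) := by linarith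
        have a2 : P.f j z - (P.m j - 1) ≤ 1 := by linarith
        have c := P.two_le_n_real (j + 1)
        rcases ih (j + 1) _ a1 (by linarith) with ⟨y, hy⟩ | ⟨u, hu0, hu1, hu2⟩
        · exact Or.inl ⟨y, Cross.pass (by ring) a1 a2 hy⟩
        · refine Or.inr ⟨fun i => Nat.casesOn i z u, rfl, ?_, ?_⟩
          · rintro (_ | i) hi
            · change 0 ≤ u 0 ∧ u 0 ≤ 1
              rw [hu0]; exact ⟨a1, a2⟩
            · exact hu1 i (by omega)
          · rintro (_ | i) hi
            · change u 0 = _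
              rw [hu0]; simp
            · change u (i + 1) = _
              rw [hu2 i (by omega)]
              push_cast
              rw [add_assoc j 1, add_comm (1 : ℤ)]
  rcases step (P.V + 1) j z h0 h1 with h | ⟨u, -, hu1, hu2⟩
  · exact h
  · refine (P.not_follows_pole (j + 1) (fun i => u (i + 1)) (fun i hi => hu1 i (by omega)) ?_).elim
    intro i hi
    have e : j + 1 + (i : ℤ) = j + ((i + 1 : ℕ) : ℤ) := by push_cast; ring
    have h2 := hu2 (i + 1) (by omega)
    rw [e]
    exact ⟨by linarith [(hu1 (i + 1) (by omega)).1], h2⟩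

/-- The leaf that arrives from the left at the coordinate `x` leaves the pole on the right at the
coordinate `y`. -/
def Rel (x y : ℝ) : Prop :=
  ∃ (j : ℤ) (z : ℝ), x = P.L j + z - 1 ∧ 1 ≤ z ∧ z ≤ P.n j ∧ P.Cross j z y

variable {P}

/-- Leaves do not cross. -/
theorem Rel.mono {x x' y y' : ℝ} (h : P.Rel x y) (h' : P.Rel x' y') (hx : x ≤ x') : y ≤ y' := by
  obtain ⟨j, z, rfl, h1, h2, hc⟩ := h
  obtain ⟨j', z', rfl, h1', h2', hc'⟩ := h'
  rcases lt_trichotomy j j' with hj | rfl | hj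
  · exact hc.le_of_lt hc' hj h1' h2'
  · exact hc.mono hc' (by linarith) (by linarith) h2'
  · -- the two leaves arrive at the common boundary of the highest rung at `j'` and the lowest rung
    -- at `j' + 1`, so they coincide
    have a := P.L_succ_real j'
    have b : (P.L (j' + 1) : ℝ) ≤ P.L j := by exact_mod_cast P.L_strictMono.monotone hj
    have hz : z = 1 := by linarith
    have hz' : z' = P.n j' := by linarith
    have hL : P.L j = P.L (j' + 1) := by
      have : (P.L j : ℝ) = P.L (j' + 1) := by linarith
      exact_mod_cast this
    have hj' := P.L_strictMono.injective hL
    subst hj' hz hz'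
    cases hc' with
    | exit h => rw [P.f_top] at h; linarith
    | pass h h0 h1 hc' =>
      rw [P.f_top] at h
      exact hc.mono hc' (by linarith) (by linarith) (by linarith)

theorem Rel.period {x y : ℝ} (h : P.Rel x y) :
    P.Rel (x + (P.L P.V - P.L 0 : ℤ)) (y + (P.R P.V - P.R 0 : ℤ)) := by
  obtain ⟨j, z, rfl, h1, h2, hc⟩ := h
  refine ⟨j + P.V, z, ?_, h1, ?_, hc.period⟩
  · rw [P.L_period]; push_cast; ring
  · rwa [P.n_period]

variable (P)

theorem exists_rel (x : ℝ) : ∃ y, P.Rel x y := by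
  have hgrow : ∀ k : ℕ, P.L 0 + k ≤ P.L k ∧ P.L (-k) ≤ P.L 0 - k := by
    intro k
    induction k with
    | zero => simp
    | succ k ih =>
      have h1 := P.L_strictMono (show (k : ℤ) < (k + 1 : ℕ) by omega)
      have h2 := P.L_strictMono (show (-(k + 1 : ℕ) : ℤ) < -k by omega)
      push_cast at h1 h2 ⊢
      omega
  have hex : ∃ j : ℤ, (P.L j : ℝ) ≤ x := by
    obtain ⟨k, hk⟩ := exists_nat_ge (P.L 0 - x)
    have := (hgrow k).2
    refine ⟨-k, ?_⟩
    have : (P.L (-k) : ℝ) ≤ P.L 0 - k := by exact_mod_cast this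
    linarith
  have hbd : ∃ b : ℤ, ∀ j : ℤ, (P.L j : ℝ) ≤ x → j ≤ b := by
    obtain ⟨k, hk⟩ := exists_nat_ge (x - P.L 0)
    have h1 := (hgrow k).1
    have h2 : (P.L 0 + k : ℝ) ≤ P.L k := by exact_mod_cast h1
    refine ⟨k, fun j hj => ?_⟩
    by_contra hlt
    have h3 : (P.L k : ℝ) < P.L j := by exact_mod_cast P.L_strictMono (not_le.1 hlt)
    linarith
  obtain ⟨j, hj, hmax⟩ := Int.exists_greatest_of_bdd hbd hex
  have hlt : x < P.L (j + 1) := by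
    by_contra hle
    have := hmax _ (not_lt.1 hle)
    omega
  rw [P.L_succ_real] at hlt
  obtain ⟨y, hy⟩ := P.exists_cross j (x - P.L j + 1) (by linarith) (by linarith)
  exact ⟨y, j, x - P.L j + 1, by ring, by linarith, by linarith, hy⟩

/-- The holonomy of the foliation across the ladderpole. -/
def holonomy (x : ℝ) : ℝ := (P.exists_rel x).choose

theorem rel_holonomy (x : ℝ) : P.Rel x (P.holonomy x) := (P.exists_rel x).choose_spec

variable {P} in
theorem Rel.eq_holonomy {x y : ℝ} (h : P.Rel x y) : y = P.holonomy x :=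
  le_antisymm (h.mono (P.rel_holonomy x) le_rfl) ((P.rel_holonomy x).mono h le_rfl)

theorem holonomy_monotone : Monotone P.holonomy := fun _ _ h =>
  (P.rel_holonomy _).mono (P.rel_holonomy _) h

theorem holonomy_period (x : ℝ) :
    P.holonomy (x + (P.L P.V - P.L 0 : ℤ)) = P.holonomy x + (P.R P.V - P.R 0 : ℤ) :=
  ((P.rel_holonomy x).period.eq_holonomy).symm

end PoleModel

/-! ### Ladderpoles and rungs -/

namespace VeeringTriangulation

variable {T : Type*} (τ : VeeringTriangulation T)

/-- At a red vertex, the ladderpole is the last branch of its fan in counterclockwise order, and it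
is not the only one. -/
theorem isPole_iff_of_red {c : BdryCorner T} (h : τ.col c = true) :
    (τ.IsPole c ↔ τ.side (τ.rot c) = !τ.side c) ∧ (τ.IsPole c → τ.side (τ.rot⁻¹ c) = τ.side c) := by
  have h1 := τ.triangle_cases (τ.rot c)
  have h2 := τ.triangle_cases c
  rw [side_next_next_rot, ← τ.opp_eq_next_next, col_opp, col_rot, h] at h1
  rw [isPole_iff, side_rot_inv, h]
  rw [h] at h2
  revert h1 h2
  generalize τ.side (τ.rot c) = a
  generalize τ.side c = b
  generalize τ.col c.next = x
  generalize τ.side c.next.next = d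
  cases a <;> cases b <;> cases x <;> cases d <;> simp

/-- At a blue vertex, the ladderpole is the first branch of its fan in counterclockwise order, and
it is not the only one. -/
theorem isPole_iff_of_blue {c : BdryCorner T} (h : τ.col c = false) :
    (τ.IsPole c ↔ τ.side (τ.rot⁻¹ c) = !τ.side c) ∧ (τ.IsPole c → τ.side (τ.rot c) = τ.side c) := by
  have h1 := τ.triangle_cases (τ.rot c)
  have h2 := τ.triangle_cases c
  rw [side_next_next_rot, ← τ.opp_eq_next_next, col_opp, col_rot, h] at h1
  rw [isPole_iff, side_rot_inv, h]
  rw [h] at h2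
  revert h1 h2
  generalize τ.side (τ.rot c) = a
  generalize τ.side c = b
  generalize τ.col c.next = x
  generalize τ.side c.next.next = d
  cases a <;> cases b <;> cases x <;> cases d <;> simp

/-- The position of a half-edge in its fan, counted from `0` towards the ladderpole, i.e.
counterclockwise at red vertices and clockwise at blue ones. The ladderpole has the last
position. -/
def polePos (c : BdryCorner T) : ℤ :=
  if τ.col c then τ.fanPos c else τ.fanSize (τ.side c) (τ.vertex c) - 1 - τ.fanPos c

theorem polePos_of_red {c : BdryCorner T} (h : τ.col c = true) : τ.polePos c = τ.fanPos c := by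
  rw [polePos, if_pos h]

theorem polePos_of_blue {c : BdryCorner T} (h : τ.col c = false) :
    τ.polePos c = τ.fanSize (τ.side c) (τ.vertex c) - 1 - τ.fanPos c := by
  rw [polePos, if_neg (by simp [h])]

variable [Finite T]

theorem polePos_nonneg (c : BdryCorner T) : 0 ≤ τ.polePos c := by
  have := τ.fanPos_lt c
  unfold polePos
  split_ifs <;> omega

theorem polePos_lt (c : BdryCorner T) :
    τ.polePos c < τ.fanSize (τ.side c) (τ.vertex c) := by
  have := τ.fanPos_lt c
  unfold polePos
  split_ifs <;> omega

theorem polePos_injective {c d : BdryCorner T} (hv : τ.vertex c = τ.vertex d)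
    (hs : τ.side c = τ.side d) (h : τ.polePos c = τ.polePos d) : c = d := by
  refine τ.fanPos_injective hv hs ?_
  rw [polePos, polePos, hs, hv, τ.col_eq_of_vertex_eq hv] at h
  split_ifs at h <;> omega

theorem isPole_iff_polePos (c : BdryCorner T) :
    τ.IsPole c ↔ τ.polePos c + 1 = τ.fanSize (τ.side c) (τ.vertex c) := by
  have hlt := τ.fanPos_lt c
  cases h : τ.col c with
  | true =>
    rw [(τ.isPole_iff_of_red h).1, polePos_of_red _ h, Bool.eq_not, Ne, side_rot_eq_iff]
    omega
  | false =>
    rw [(τ.isPole_iff_of_blue h).1, polePos_of_blue _ h, ← fanPos_eq_zero_iff]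
    omega

theorem exists_polePos_eq (b : Bool) (v : τ.BdryVertex) (k : ℕ) (hk : k < τ.fanSize b v) :
    ∃ c, τ.vertex c = v ∧ τ.side c = b ∧ τ.polePos c = k := by
  cases h : τ.vcol v with
  | true =>
    obtain ⟨c, rfl, h2, h3⟩ := (τ.exists_fanPos_eq_iff b v k).2 hk
    exact ⟨c, rfl, h2, by rw [polePos_of_red _ h, h3]⟩
  | false =>
    obtain ⟨c, rfl, h2, h3⟩ := (τ.exists_fanPos_eq_iff b v (τ.fanSize b v - 1 - k)).2 (by omega)
    exact ⟨c, rfl, h2, by rw [polePos_of_blue _ h, h3, h2]; omega⟩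

theorem exists_pole (b : Bool) (v : τ.BdryVertex) :
    ∃ c, τ.vertex c = v ∧ τ.side c = b ∧ τ.IsPole c := by
  have hpos : 0 < τ.fanSize b v := by
    obtain ⟨c, ⟨rfl, rfl, -⟩, -⟩ := τ.existsUnique_start b v
    exact (Nat.zero_le _).trans_lt (τ.fanPos_lt c)
  obtain ⟨c, rfl, rfl, h3⟩ := τ.exists_polePos_eq b v (τ.fanSize b v - 1) (by omega)
  exact ⟨c, rfl, rfl, by rw [isPole_iff_polePos]; omega⟩

theorem two_le_fanSize (b : Bool) (v : τ.BdryVertex) : 2 ≤ τ.fanSize b v := by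
  obtain ⟨c, rfl, rfl, hp⟩ := τ.exists_pole b v
  have hlt := τ.fanPos_lt c
  cases h : τ.col c with
  | true =>
    have := τ.fanPos_eq_succ c ((τ.isPole_iff_of_red h).2 hp)
    omega
  | false =>
    have := (τ.side_rot_eq_iff c).1 ((τ.isPole_iff_of_blue h).2 hp)
    omega

theorem pole_unique {c d : BdryCorner T} (hv : τ.vertex c = τ.vertex d)
    (hs : τ.side c = τ.side d) (hc : τ.IsPole c) (hd : τ.IsPole d) : c = d := by
  rw [isPole_iff_polePos] at hc hd
  refine τ.polePos_injective hv hs ?_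
  rw [hv, hs] at hc
  omega

/-- The ladderpoles through red vertices are upward. Only the colour of the vertices enters, because
the place of the ladderpole in a fan depends on nothing else. -/
theorem isUpward_of_red {v : τ.BdryVertex}
    (hconn : ∀ w, τ.ladderpole w = τ.ladderpole v → τ.vcol w = true) :
    τ.IsUpward (τ.ladderpole v) := by
  intro c d hcd hc hp hd
  have hred : τ.col c = true := hconn _ hc
  have hred' : τ.col d = true := (τ.col_eq_of_vertex_eq hcd) ▸ hred
  rw [isPole_iff_polePos, polePos_of_red _ hred] at hp
  rw [isPole_iff_polePos, polePos_of_red _ hred'] at hd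
  have hlt := τ.fanPos_lt d
  constructor
  · intro h1 h2
    rw [isRight_iff] at h1 h2
    rw [rightPos_eq _ h1, rightPos_eq _ h2]
    rw [h1, hcd] at hp
    rw [h2] at hd hlt
    omega
  · intro h1 h2
    rw [isRight_iff, Bool.not_eq_true] at h1 h2
    have e1 := τ.leftPos_add_fanPos h1
    have e2 := τ.leftPos_add_fanPos h2
    rw [h1] at hp
    rw [h2] at hd hlt
    rw [hcd] at e1 hp
    omega

/-- The ladderpoles through blue vertices are downward. -/
theorem isDownward_of_blue {v : τ.BdryVertex}
    (hconn : ∀ w, τ.ladderpole w = τ.ladderpole v → τ.vcol w = false) :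
    τ.IsDownward (τ.ladderpole v) := by
  intro c d hcd hc hp hd
  have hblue : τ.col c = false := hconn _ hc
  have hblue' : τ.col d = false := (τ.col_eq_of_vertex_eq hcd) ▸ hblue
  rw [isPole_iff_polePos, polePos_of_blue _ hblue] at hp
  rw [isPole_iff_polePos, polePos_of_blue _ hblue'] at hd
  have hlt := τ.fanPos_lt d
  constructor
  · intro h1 h2
    rw [isRight_iff] at h1 h2
    rw [rightPos_eq _ h1, rightPos_eq _ h2]
    omega
  · intro h1 h2
    rw [isRight_iff, Bool.not_eq_true] at h1 h2
    have e1 := τ.leftPos_add_fanPos h1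
    have e2 := τ.leftPos_add_fanPos h2
    rw [hcd] at e1
    omega

end VeeringTriangulation

/-! ### Ladders -/

namespace VeeringTriangulation

variable {T : Type*} (τ : VeeringTriangulation T)

/-- The rung next to the rung `c` in its ladder, across the triangle that is entered by the
counterclockwise turn at `c`. This is the rung above `c` if `c` is on the right of its vertex, and
the rung below `c` otherwise. -/
def nextRung (c : BdryCorner T) : BdryCorner T :=
  if τ.col (τ.rot c).next = τ.col (τ.rot c) then (τ.rot c).next else τ.rot c

theorem col_next_ne {c : BdryCorner T} (hc : ¬ τ.IsPole c) : τ.col c.next = !τ.col c := by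
  rw [isPole_iff, eq_comm] at hc
  exact Bool.eq_not.2 hc

theorem col_next_next_rot (c : BdryCorner T) : τ.col (τ.rot c).next.next = τ.col c.next := by
  rw [← τ.opp_eq_next_next, col_opp]

/-- The next rung lies in the same ladder. -/
theorem nextRung_spec {c : BdryCorner T} (hc : ¬ τ.IsPole c) :
    ¬ τ.IsPole (τ.nextRung c) ∧ τ.side (τ.nextRung c) = τ.side c ∧
      τ.col (τ.nextRung c) = τ.col c := by
  have h1 := τ.triangle_cases (τ.rot c)
  have h2 := τ.col_next_ne hc
  rw [side_next_next_rot, col_next_next_rot, col_rot, h2] at h1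
  unfold nextRung
  split_ifs with h
  · rw [isPole_iff, col_next_next_rot, h2, h, col_rot]
    rw [col_rot] at h
    rw [h] at h1
    revert h1
    generalize τ.side (τ.rot c) = a
    generalize τ.side c = b
    generalize τ.side (τ.rot c).next = d
    generalize τ.col c = x
    cases a <;> cases b <;> cases x <;> cases d <;> simp
  · rw [isPole_iff, eq_comm, col_rot]
    rw [col_rot] at h
    rw [← Ne, ← Bool.eq_not] at h
    rw [h] at h1 ⊢
    revert h1
    generalize τ.side (τ.rot c) = a
    generalize τ.side c = b
    generalize τ.side (τ.rot c).next = d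
    generalize τ.col c = x
    cases a <;> cases b <;> cases x <;> cases d <;> simp

/-- Seen from the other end, the passage to the next rung is undone. -/
theorem nextRung_opp_nextRung {c : BdryCorner T} (hc : ¬ τ.IsPole c) :
    τ.nextRung (τ.opp (τ.nextRung c)) = τ.opp c := by
  have h2 := τ.col_next_ne hc
  conv_lhs => rw [nextRung]
  rw [τ.rot_opp]
  by_cases h : τ.col (τ.rot c).next = τ.col (τ.rot c)
  · have e : τ.nextRung c = (τ.rot c).next := if_pos h
    rw [e, if_neg, τ.opp_eq_next_next]
    rw [BdryCorner.next_next_next, col_rot, col_next_next_rot, h2]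
    simp
  · have e : τ.nextRung c = τ.rot c := if_neg h
    rw [e, if_pos, τ.opp_eq_next_next]
    rw [col_next_next_rot, h2, Bool.eq_not.2 h, col_rot]

variable {τ} (D : τ.Drawing)

/-- The number of times that the top side of the rectangle is crossed by the path from the end of
the rung `c` named by `c` to the corresponding end of the next rung. -/
def Drawing.nextSheet (c : BdryCorner T) : ℤ :=
  if τ.col (τ.rot c).next = τ.col (τ.rot c) then D.wrap (τ.rot c) else 0

/-- The sides of the triangle between a rung and the next one close up in the plane. -/
theorem Drawing.nextSheet_opp {c : BdryCorner T} (hc : ¬ τ.IsPole c) :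
    D.nextSheet c + D.wrap (τ.nextRung c) + D.nextSheet (τ.opp (τ.nextRung c)) = D.wrap c := by
  have h2 := τ.col_next_ne hc
  have ht := D.wrap_triangle (τ.rot c)
  rw [← τ.opp_eq_next_next, D.wrap_opp] at ht
  by_cases h : τ.col (τ.rot c).next = τ.col (τ.rot c)
  · have e : τ.nextRung c = (τ.rot c).next := if_pos h
    have e1 : D.nextSheet c = D.wrap (τ.rot c) := if_pos h
    have e2 : D.nextSheet (τ.opp (τ.nextRung c)) = 0 := by
      rw [e, nextSheet, τ.rot_opp, if_neg]
      rw [BdryCorner.next_next_next, col_rot, col_next_next_rot, h2]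
      simp
    rw [e1, e2, e]
    linarith
  · have e : τ.nextRung c = τ.rot c := if_neg h
    have e1 : D.nextSheet c = 0 := if_neg h
    have e2 : D.nextSheet (τ.opp (τ.nextRung c)) = D.wrap (τ.rot c).next := by
      rw [e, nextSheet, τ.rot_opp, if_pos]
      rw [col_next_next_rot, h2, Bool.eq_not.2 h, col_rot]
    rw [e1, e2, e]
    linarith

/-- The sign of a colour: the pole goes up at red vertices, and down at blue ones. -/
def colSign (κ : Bool) : ℤ := if κ then 1 else -1

variable [Finite T]

/-- The next rung either is the next branch of the same fan, or it lies at the other end of the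
ladderpole edge that separates the two rungs. -/
theorem Drawing.nextRung_cases {c : BdryCorner T} (hc : ¬ τ.IsPole c) :
    (τ.vertex (τ.nextRung c) = τ.vertex c ∧ D.nextSheet c = 0 ∧
      τ.polePos (τ.nextRung c) = τ.polePos c + colSign (τ.col c)) ∨
    ∃ d, τ.IsPole d ∧ τ.vertex d = τ.vertex c ∧ τ.vertex (τ.nextRung c) = τ.vertex (τ.opp d) ∧
      D.nextSheet c = D.wrap d ∧
      ((τ.col c = true ∧ τ.side d = τ.side c ∧ τ.polePos (τ.nextRung c) = 0 ∧
        τ.polePos c + 2 = τ.fanSize (τ.side c) (τ.vertex c)) ∨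
      (τ.col c = false ∧ τ.side d = (!τ.side c) ∧ τ.polePos c = 0 ∧
        τ.polePos (τ.nextRung c) + 2 =
          τ.fanSize (τ.side c) (τ.vertex (τ.nextRung c)))) := by
  obtain ⟨-, hs, hcol⟩ := τ.nextRung_spec hc
  have h2 := τ.col_next_ne hc
  have h1 := τ.triangle_cases (τ.rot c)
  rw [side_next_next_rot, col_next_next_rot, col_rot, h2] at h1
  by_cases h : τ.col (τ.rot c).next = τ.col (τ.rot c)
  · right
    have e : τ.nextRung c = (τ.rot c).next := if_pos h
    have e1 : D.nextSheet c = D.wrap (τ.rot c) := if_pos h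
    have hp : τ.IsPole (τ.rot c) := (τ.isPole_iff _).2 h.symm
    have hv : τ.vertex (τ.nextRung c) = τ.vertex (τ.opp (τ.rot c)) := by
      rw [e, τ.vertex_opp]
    have hro : τ.rot⁻¹ (τ.nextRung c) = τ.opp (τ.rot c) := by rw [e, τ.opp_eq]
    refine ⟨τ.rot c, hp, τ.vertex_rot c, hv, e1, ?_⟩
    rw [col_rot] at h
    rw [h] at h1
    cases hκ : τ.col c with
    | true =>
      left
      rw [hκ] at h1
      have hsd : τ.side (τ.rot c) = τ.side c := by
        revert h1
        cases τ.side (τ.rot c) <;> cases τ.side c <;> simp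
      refine ⟨rfl, hsd, ?_, ?_⟩
      · rw [polePos_of_red _ (hcol.trans hκ), Nat.cast_eq_zero, fanPos_eq_zero_iff, hro, side_opp,
          hsd, hs]
      · have h3 := (τ.isPole_iff_polePos _).1 hp
        rw [polePos_of_red _ ((τ.col_rot c).trans hκ), τ.fanPos_rot c hsd, hsd, τ.vertex_rot] at h3
        rw [polePos_of_red _ hκ]
        push_cast at h3
        linarith
    | false =>
      right
      rw [hκ] at h1
      have hsd : τ.side (τ.rot c) = !τ.side c := by
        revert h1
        cases τ.side (τ.rot c) <;> cases τ.side c <;> simp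
      refine ⟨rfl, hsd, ?_, ?_⟩
      · have h3 : ¬ τ.fanPos c + 1 < τ.fanSize (τ.side c) (τ.vertex c) := by
          rw [← side_rot_eq_iff, hsd]
          simp
        have h4 := τ.fanPos_lt c
        rw [polePos_of_blue _ hκ]
        omega
      · have hso : τ.side (τ.opp (τ.rot c)) = τ.side (τ.nextRung c) := by
          rw [side_opp, hsd, hs, Bool.not_not]
        have h3 := τ.fanPos_eq_succ (τ.nextRung c) (by rw [hro, hso])
        have h4 : τ.fanPos (τ.opp (τ.rot c)) = 0 := by
          rw [fanPos_eq_zero_iff, ← (τ.isPole_iff_of_blue _).1, isPole_opp]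
          · exact hp
          · rw [col_opp, h, hκ]
        rw [polePos_of_blue _ (hcol.trans hκ), h3, hro, h4, hs]
        push_cast
        ring
  · left
    have e : τ.nextRung c = τ.rot c := if_neg h
    have e1 : D.nextSheet c = 0 := if_neg h
    rw [e] at hs ⊢
    refine ⟨τ.vertex_rot c, e1, ?_⟩
    have h4 := τ.fanPos_rot c hs
    cases hκ : τ.col c with
    | true =>
      rw [polePos_of_red _ hκ, polePos_of_red _ ((τ.col_rot c).trans hκ), h4]
      simp [colSign]
    | false =>
      rw [polePos_of_blue _ hκ, polePos_of_blue _ ((τ.col_rot c).trans hκ), h4, hs, τ.vertex_rot]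
      simp [colSign]
      ring

end VeeringTriangulation

/-! ### Lifts of the two ladderpoles -/

namespace VeeringTriangulation

variable {T : Type*} (τ : VeeringTriangulation T)

theorem vcol_eq_of_ladderpole_eq {v w : τ.BdryVertex} (h : τ.ladderpole v = τ.ladderpole w) :
    τ.vcol v = τ.vcol w := by
  let g : τ.Ladderpole → Bool := Quot.lift τ.vcol (by
    rintro v w ⟨c, hc, rfl, rfl⟩
    rw [vcol_vertex, vcol_vertex, col_opp]
    exact (τ.isPole_iff c).1 hc)
  exact congrArg g h

variable [Finite T]

instance : Finite τ.BdryVertex := Quotient.finite _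

/-- The ladderpole edge on the right of a vertex. -/
def rightPole (v : τ.BdryVertex) : BdryCorner T := (τ.exists_pole true v).choose

theorem vertex_rightPole (v : τ.BdryVertex) : τ.vertex (τ.rightPole v) = v :=
  (τ.exists_pole true v).choose_spec.1

theorem side_rightPole (v : τ.BdryVertex) : τ.side (τ.rightPole v) = true :=
  (τ.exists_pole true v).choose_spec.2.1

theorem isPole_rightPole (v : τ.BdryVertex) : τ.IsPole (τ.rightPole v) :=
  (τ.exists_pole true v).choose_spec.2.2

theorem rightPole_vertex {c : BdryCorner T} (hs : τ.side c = true) (hc : τ.IsPole c) :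
    τ.rightPole (τ.vertex c) = c :=
  τ.pole_unique (τ.vertex_rightPole _) ((τ.side_rightPole _).trans hs.symm)
    (τ.isPole_rightPole _) hc

/-- The vertex after `v` on its ladderpole, from left to right. -/
def poleNext : Perm τ.BdryVertex :=
  Equiv.ofBijective (fun v => τ.vertex (τ.opp (τ.rightPole v))) (by
    refine Finite.injective_iff_bijective.1 fun v w h => ?_
    have h2 := τ.pole_unique h (by rw [side_opp, side_opp, side_rightPole, side_rightPole])
      ((τ.isPole_opp _).2 (τ.isPole_rightPole v)) ((τ.isPole_opp _).2 (τ.isPole_rightPole w))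
    have h3 := congrArg τ.opp h2
    rw [τ.opp_opp, τ.opp_opp] at h3
    rw [← τ.vertex_rightPole v, h3, τ.vertex_rightPole])

theorem poleNext_apply (v : τ.BdryVertex) :
    τ.poleNext v = τ.vertex (τ.opp (τ.rightPole v)) := rfl

theorem poleNext_vertex {c : BdryCorner T} (hs : τ.side c = true) (hc : τ.IsPole c) :
    τ.poleNext (τ.vertex c) = τ.vertex (τ.opp c) := by
  rw [poleNext_apply, τ.rightPole_vertex hs hc]

theorem ladderpole_poleNext (v : τ.BdryVertex) :
    τ.ladderpole (τ.poleNext v) = τ.ladderpole v :=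
  (Quot.sound ⟨τ.rightPole v, τ.isPole_rightPole v, τ.vertex_rightPole v, rfl⟩).symm

theorem vcol_poleNext (v : τ.BdryVertex) : τ.vcol (τ.poleNext v) = τ.vcol v :=
  τ.vcol_eq_of_ladderpole_eq (τ.ladderpole_poleNext v)

theorem sameCycle_of_ladderpole_eq {v w : τ.BdryVertex} (h : τ.ladderpole v = τ.ladderpole w) :
    τ.poleNext.SameCycle v w := by
  let g : τ.Ladderpole → Quotient (SameCycle.setoid τ.poleNext) :=
    Quot.lift (fun v => Quotient.mk _ v) (by
      rintro v w ⟨c, hc, rfl, rfl⟩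
      refine Quotient.sound (?_ : τ.poleNext.SameCycle _ _)
      cases hs : τ.side c with
      | true =>
        rw [← τ.poleNext_vertex hs hc]
        exact sameCycle_apply_right.2 (SameCycle.refl _ _)
      | false =>
        have := τ.poleNext_vertex (c := τ.opp c) (by rw [side_opp, hs]; rfl)
          ((τ.isPole_opp c).2 hc)
        rw [τ.opp_opp] at this
        rw [← this]
        exact sameCycle_apply_left.2 (SameCycle.refl _ _))
  exact Quotient.exact (congrArg g h)

/-- The vertices of a given colour. -/
def colVertices (κ : Bool) : Finset τ.BdryVertex := (Set.toFinite {v | τ.vcol v = κ}).toFinset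

variable {τ} in
theorem mem_colVertices {κ : Bool} {v : τ.BdryVertex} : v ∈ τ.colVertices κ ↔ τ.vcol v = κ := by
  simp [colVertices]

theorem colVertices_nonempty [Nonempty T] (κ : Bool) : (τ.colVertices κ).Nonempty := by
  obtain ⟨t⟩ := ‹Nonempty T›
  let c : BdryCorner T := (t, 1)
  have : ∃ d, τ.col d = κ := by
    rcases τ.triangle_cases c with ⟨-, -, h1, h2⟩ | ⟨-, -, h1, h2⟩ | ⟨-, -, h1, h2⟩ <;> cases κ
    all_goals exact ⟨_, by assumption⟩
  obtain ⟨d, hd⟩ := this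
  exact ⟨τ.vertex d, mem_colVertices.2 hd⟩

/-- If there is just one upward and one downward ladderpole, then all vertices of a colour lie on
one ladderpole. -/
theorem ladderpole_eq_of_vcol_eq (h_up : ∃! q : τ.Ladderpole, τ.IsUpward q)
    (h_down : ∃! q : τ.Ladderpole, τ.IsDownward q) {v w : τ.BdryVertex}
    (h : τ.vcol v = τ.vcol w) : τ.ladderpole v = τ.ladderpole w := by
  cases hv : τ.vcol v with
  | true =>
    refine h_up.unique (τ.isUpward_of_red fun u hu => ?_) (τ.isUpward_of_red fun u hu => ?_)
    · rw [τ.vcol_eq_of_ladderpole_eq hu, hv]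
    · rw [τ.vcol_eq_of_ladderpole_eq hu, ← h, hv]
  | false =>
    refine h_down.unique (τ.isDownward_of_blue fun u hu => ?_)
      (τ.isDownward_of_blue fun u hu => ?_)
    · rw [τ.vcol_eq_of_ladderpole_eq hu, hv]
    · rw [τ.vcol_eq_of_ladderpole_eq hu, ← h, hv]

theorem isCycleOn_colVertices
    (hlad : ∀ v w : τ.BdryVertex, τ.vcol v = τ.vcol w → τ.ladderpole v = τ.ladderpole w) (κ : Bool) :
    τ.poleNext.IsCycleOn (τ.colVertices κ) := by
  refine ⟨⟨fun v hv => ?_, τ.poleNext.injective.injOn, fun v hv => ?_⟩, fun v hv w hw => ?_⟩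
  · rw [Finset.mem_coe, mem_colVertices] at hv ⊢
    rw [vcol_poleNext, hv]
  · rw [Finset.mem_coe, mem_colVertices] at hv
    refine ⟨τ.poleNext.symm v, ?_, τ.poleNext.apply_symm_apply v⟩
    rw [Finset.mem_coe, mem_colVertices, ← vcol_poleNext, τ.poleNext.apply_symm_apply, hv]
  · rw [Finset.mem_coe, mem_colVertices] at hv hw
    exact τ.sameCycle_of_ladderpole_eq (hlad v w (hv.trans hw.symm))

variable {τ} {D : τ.Drawing}

theorem Drawing.rise_rightPole (v : τ.BdryVertex) :
    D.rise (τ.rightPole v) = D.height (τ.poleNext v) - D.height v + D.wrap (τ.rightPole v) := by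
  rw [rise, τ.vertex_rightPole]
  rfl

theorem Drawing.IsStandard.rise_pole_pos {T : Type*} [Fintype T] {τ : VeeringTriangulation T}
    {D : τ.Drawing} (hD : D.IsStandard) {c : BdryCorner T}
    (hs : τ.side c = true) (hc : τ.IsPole c) : 0 < colSign (τ.col c) * D.rise c := by
  cases hκ : τ.col c with
  | true =>
    have := hD.rise_up c hs hc (τ.isUpward_of_red fun w hw => by
      rw [τ.vcol_eq_of_ladderpole_eq hw, vcol_vertex, hκ])
    simpa [colSign] using this
  | false =>
    have := hD.rise_down c hs hc (τ.isDownward_of_blue fun w hw => by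
      rw [τ.vcol_eq_of_ladderpole_eq hw, vcol_vertex, hκ])
    simpa [colSign] using this

theorem colSign_mul_self (κ : Bool) : colSign κ * colSign κ = 1 := by cases κ <;> rfl

theorem colSign_mul_self_real (κ : Bool) : (colSign κ : ℝ) * colSign κ = 1 := by
  exact_mod_cast colSign_mul_self κ

theorem colSign_not (κ : Bool) : colSign (!κ) = -colSign κ := by cases κ <;> rfl

/-- The ladderpole of colour `κ` winds around once. -/
theorem Drawing.IsStandard.sum_wrap {T : Type*} [Fintype T] [Nonempty T]
    {τ : VeeringTriangulation T} {D : τ.Drawing} (hD : D.IsStandard)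
    (hlad : ∀ v w : τ.BdryVertex, τ.vcol v = τ.vcol w → τ.ladderpole v = τ.ladderpole w)
    (κ : Bool) : ∑ v ∈ τ.colVertices κ, D.wrap (τ.rightPole v) = colSign κ := by
  classical
  obtain ⟨v₀, hv₀⟩ := τ.colVertices_nonempty κ
  rw [mem_colVertices] at hv₀
  have h1 := hD.pole_total (τ.ladderpole v₀)
  have h2 : ∑ v ∈ τ.colVertices κ, |D.rise (τ.rightPole v)| = 1 := by
    rw [← h1]
    refine Finset.sum_nbij τ.rightPole ?_ ?_ ?_ (fun _ _ => rfl)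
    · intro v hv
      rw [mem_colVertices] at hv
      simp only [Finset.mem_filter, Finset.mem_univ, true_and]
      refine ⟨τ.side_rightPole v, τ.isPole_rightPole v, ?_⟩
      rw [τ.vertex_rightPole]
      exact hlad _ _ (hv.trans hv₀.symm)
    · intro v _ w _ h
      have h' : τ.rightPole v = τ.rightPole w := h
      rw [← τ.vertex_rightPole v, h', τ.vertex_rightPole]
    · intro c hc
      simp only [Finset.coe_filter, Finset.mem_univ, true_and] at hc
      obtain ⟨hr, hp, hq⟩ := hc
      refine ⟨τ.vertex c, ?_, τ.rightPole_vertex hr hp⟩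
      rw [Finset.mem_coe, mem_colVertices, τ.vcol_eq_of_ladderpole_eq hq, hv₀]
  have h3 : ∀ v ∈ τ.colVertices κ, |D.rise (τ.rightPole v)| =
      colSign κ * (D.height (τ.poleNext v) - D.height v) +
        colSign κ * (D.wrap (τ.rightPole v) : ℝ) := by
    intro v hv
    rw [mem_colVertices] at hv
    have h4 := hD.rise_pole_pos (τ.side_rightPole v) (τ.isPole_rightPole v)
    rw [← vcol_vertex, τ.vertex_rightPole, hv] at h4
    have h5 : |D.rise (τ.rightPole v)| = colSign κ * D.rise (τ.rightPole v) := by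
      revert h4
      cases κ <;> simp only [colSign] <;> intro h4
      · rw [abs_of_neg] <;> simp at h4 ⊢; exact h4
      · rw [abs_of_pos] <;> simp at h4 ⊢; exact h4
    rw [h5, Drawing.rise_rightPole]
    ring
  rw [Finset.sum_congr rfl h3, Finset.sum_add_distrib, ← Finset.mul_sum, ← Finset.mul_sum,
    Finset.sum_sub_distrib] at h2
  have h6 : ∑ v ∈ τ.colVertices κ, D.height (τ.poleNext v) =
      ∑ v ∈ τ.colVertices κ, D.height v :=
    Finset.sum_equiv τ.poleNext (fun v => by rw [mem_colVertices, mem_colVertices, vcol_poleNext])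
      (fun _ _ => rfl)
  -- the differences of the heights cancel around the ladderpole, and the crossings remain
  rw [h6, sub_self, mul_zero, zero_add] at h2
  have h7 : colSign κ * ∑ v ∈ τ.colVertices κ, D.wrap (τ.rightPole v) = 1 := by exact_mod_cast h2
  have h8 := colSign_mul_self κ
  generalize ∑ v ∈ τ.colVertices κ, D.wrap (τ.rightPole v) = S at h7 ⊢
  linear_combination colSign κ * h7 - S * h8

variable (D) in
/-- A numbering by the integers of the lifts of the vertices of colour `κ`, in their order from left
to right along the lifted ladderpole. A lift of the vertex `v` is a pair `(v, W)` with `W : ℤ`, and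
the number of this lift is `J v W`; conversely the lift with number `j` is one of `a j`. -/
structure PoleIndex (κ : Bool) where
  a : ℤ → τ.BdryVertex
  J : τ.BdryVertex → ℤ → ℤ
  vcol_a : ∀ j, τ.vcol (a j) = κ
  a_period : ∀ j, a (j + (τ.colVertices κ).card) = a j
  a_J : ∀ v W, τ.vcol v = κ → a (J v W) = v
  J_opp : ∀ c W, τ.side c = true → τ.IsPole c → τ.col c = κ →
    J (τ.vertex (τ.opp c)) (W + D.wrap c) = J (τ.vertex c) W + 1
  J_add_one : ∀ v W, τ.vcol v = κ → J v (W + 1) = J v W + colSign κ * (τ.colVertices κ).card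
  exists_J_eq : ∀ j, ∃ W, J (a j) W = j

theorem Drawing.IsStandard.exists_poleIndex {T : Type*} [Fintype T] [Nonempty T]
    {τ : VeeringTriangulation T} {D : τ.Drawing} (hD : D.IsStandard)
    (hlad : ∀ v w : τ.BdryVertex, τ.vcol v = τ.vcol w → τ.ladderpole v = τ.ladderpole w)
    (κ : Bool) : Nonempty (PoleIndex D κ) := by
  obtain ⟨a, J, h1, -, h3, h4, h5, h6, h7⟩ := exists_lift_index τ.poleNext (τ.colVertices κ)
    (τ.isCycleOn_colVertices hlad κ) (τ.colVertices_nonempty κ) (fun v => D.wrap (τ.rightPole v))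
    (colSign κ) (colSign_mul_self κ) (hD.sum_wrap hlad κ)
  refine ⟨⟨a, J, fun j => mem_colVertices.1 (h1 j), h3, fun v W hv => h4 v (mem_colVertices.2 hv) W,
    fun c W hs hp hc => ?_, fun v W hv => h6 v (mem_colVertices.2 hv) W, h7⟩⟩
  have := h5 (τ.vertex c) (mem_colVertices.2 hc) W
  rwa [τ.poleNext_vertex hs hp, τ.rightPole_vertex hs hp] at this

namespace PoleIndex

variable {κ : Bool} (I : PoleIndex D κ)

theorem J_eq (v : τ.BdryVertex) (W : ℤ) (hv : τ.vcol v = κ) :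
    I.J v W = I.J v 0 + W * (colSign κ * (τ.colVertices κ).card) := by
  have := eq_apply_zero_of_forall_succ_eq
    (fun W => I.J v W - W * (colSign κ * (τ.colVertices κ).card)) (fun W => by
      have := I.J_add_one v W hv
      simp only [this]
      ring) W
  simp only [zero_mul, sub_zero] at this
  linarith

theorem card_pos (I : PoleIndex D κ) : 0 < (τ.colVertices κ).card :=
  Finset.card_pos.2 ⟨I.a 0, mem_colVertices.2 (I.vcol_a 0)⟩

theorem J_injective {v v' : τ.BdryVertex} {W W' : ℤ} (hv : τ.vcol v = κ) (hv' : τ.vcol v' = κ)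
    (h : I.J v W = I.J v' W') : v = v' ∧ W = W' := by
  have h1 : v = v' := by rw [← I.a_J v W hv, h, I.a_J v' W' hv']
  subst h1
  refine ⟨rfl, ?_⟩
  rw [I.J_eq v W hv, I.J_eq v W' hv, add_right_inj] at h
  have hc : (0 : ℤ) < (τ.colVertices κ).card := by exact_mod_cast I.card_pos
  refine mul_right_cancel₀ (mul_ne_zero ?_ hc.ne') h
  intro h0
  have := colSign_mul_self κ
  rw [h0] at this
  simp at this

end PoleIndex

end VeeringTriangulation

namespace VeeringTriangulation

variable {T : Type*} (τ : VeeringTriangulation T)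

/-! ### The two ends of an edge -/

/-- No face is glued to itself, since its two sides have opposite coorientations. -/
theorem rot_ne_rev (c : BdryCorner T) : τ.rot c ≠ c.rev := by
  intro h
  have h1 : τ.out (τ.rot c).1 ((τ.rot c).2.1 3) = !τ.side c := by
    rw [side, ← τ.out_glue]
    simp only [IdealTriangulation.rot_apply, IdealTriangulation.cross, Perm.mul_apply]
    congr 3
  have h2 : τ.out c.rev.1 (c.rev.2.1 3) = τ.side c := by
    simp only [BdryCorner.rev, side, Perm.mul_apply]
    congr 2
  rw [h, h2] at h1
  simp at h1

/-- An edge of the triangulation is not glued to itself with its ends exchanged. -/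
theorem vertex_rev_ne [Finite T] (c : BdryCorner T) : τ.vertex c.rev ≠ τ.vertex c := by
  -- `rev` reverses the cyclic order of the corners around the edge, so if it maps this cycle to
  -- itself, then it fixes a corner or exchanges two adjacent ones
  have key : ∀ (k : ℕ) (c : BdryCorner T), (τ.rot ^ k) c ≠ c.rev := by
    intro k
    induction k using Nat.twoStepInduction with
    | zero => exact fun c h => c.rev_ne h.symm
    | one => exact fun c => by rw [pow_one]; exact τ.rot_ne_rev c
    | more k ih _ =>
      intro c h
      apply ih (τ.rot c)
      rw [τ.rev_rot, ← h, ← Perm.mul_apply, ← Perm.mul_apply, pow_succ, pow_succ', mul_assoc,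
        ← mul_assoc, inv_mul_cancel, one_mul, ← pow_succ, pow_succ]
  intro h
  obtain ⟨k, -, -, hk⟩ := (τ.vertex_eq_iff.1 h.symm).exists_pow_eq''
  exact key k c hk

variable {τ}

namespace HolonomySolution

variable (F : τ.HolonomySolution)

/-- The gluing map at the vertex `v`, from the left fan to the right fan, extended to `ℝ`. -/
def gluing (v : τ.BdryVertex) (x : ℝ) : ℝ :=
  F.f v (projIcc 0 (τ.leftSize v : ℝ) (Nat.cast_nonneg _) x)

theorem gluing_of_mem {v : τ.BdryVertex} (x : Icc (0 : ℝ) (τ.leftSize v)) :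
    F.gluing v x = F.f v x := by
  rw [gluing, projIcc_val]

theorem gluing_mem (v : τ.BdryVertex) (x : ℝ) : F.gluing v x ∈ Icc (0 : ℝ) (τ.rightSize v) :=
  Subtype.coe_prop _

theorem gluing_strictMonoOn (v : τ.BdryVertex) :
    StrictMonoOn (F.gluing v) (Icc 0 (τ.leftSize v)) := by
  intro x hx y hy hxy
  rw [F.gluing_of_mem ⟨x, hx⟩, F.gluing_of_mem ⟨y, hy⟩]
  exact F.mono v hxy

theorem gluing_zero (v : τ.BdryVertex) : F.gluing v 0 = 0 := by
  refine le_antisymm ?_ (F.gluing_mem v 0).1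
  obtain ⟨x, hx⟩ := (F.f v).surjective ⟨0, le_rfl, Nat.cast_nonneg _⟩
  have h0 : (0 : ℝ) ∈ Icc (0 : ℝ) (τ.leftSize v) := ⟨le_rfl, Nat.cast_nonneg _⟩
  have h1 := (F.gluing_strictMonoOn v).monotoneOn h0 x.2 x.2.1
  rwa [F.gluing_of_mem x, hx] at h1

theorem gluing_leftSize (v : τ.BdryVertex) : F.gluing v (τ.leftSize v) = τ.rightSize v := by
  refine le_antisymm (F.gluing_mem v _).2 ?_
  obtain ⟨x, hx⟩ := (F.f v).surjective ⟨τ.rightSize v, Nat.cast_nonneg _, le_rfl⟩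
  have h0 : (τ.leftSize v : ℝ) ∈ Icc (0 : ℝ) (τ.leftSize v) := ⟨Nat.cast_nonneg _, le_rfl⟩
  have h1 := (F.gluing_strictMonoOn v).monotoneOn x.2 h0 x.2.2
  rwa [F.gluing_of_mem x, hx] at h1

theorem gluing_rev (c : BdryCorner T) {x : ℝ} (hx : x ∈ Icc (0 : ℝ) (τ.leftSize (τ.vertex c))) :
    F.gluing (τ.vertex c) x ≤ τ.leftSize (τ.vertex c.rev) ∧
      F.gluing (τ.vertex c.rev) (F.gluing (τ.vertex c) x) = x := by
  obtain ⟨y, h1, h2⟩ := F.f_rev c ⟨x, hx⟩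
  rw [← F.gluing_of_mem] at h1 h2
  rw [← h1]
  exact ⟨y.2.2, h2⟩

theorem size_rev (F : τ.HolonomySolution) (c : BdryCorner T) :
    τ.leftSize (τ.vertex c.rev) = τ.rightSize (τ.vertex c) ∧
    τ.rightSize (τ.vertex c.rev) = τ.leftSize (τ.vertex c) := by
  have key : ∀ c : BdryCorner T, τ.rightSize (τ.vertex c) ≤ τ.leftSize (τ.vertex c.rev) := by
    intro c
    have h := F.gluing_rev c (x := τ.leftSize (τ.vertex c)) ⟨Nat.cast_nonneg _, le_rfl⟩
    rw [F.gluing_leftSize] at h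
    exact_mod_cast h.1
  have key2 : ∀ c : BdryCorner T, τ.leftSize (τ.vertex c) ≤ τ.rightSize (τ.vertex c.rev) := by
    intro c
    have h := F.gluing_rev c (x := τ.leftSize (τ.vertex c)) ⟨Nat.cast_nonneg _, le_rfl⟩
    have h3 := (F.gluing_mem (τ.vertex c.rev) (F.gluing (τ.vertex c) (τ.leftSize (τ.vertex c)))).2
    rw [h.2] at h3
    exact_mod_cast h3
  have h1 := key c
  have h2 := key2 c
  have h3 := key c.rev
  have h4 := key2 c.rev
  rw [c.rev_rev] at h3 h4
  exact ⟨le_antisymm h4 h1, le_antisymm h3 h2⟩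

/-- The gluing map at a vertex of colour `κ`, turned upside down at blue vertices, so that the
ladderpole goes up in both cases. -/
def poleGluing (κ : Bool) (v : τ.BdryVertex) (x : ℝ) : ℝ :=
  if κ then F.gluing v x else τ.rightSize v - F.gluing v (τ.leftSize v - x)

theorem poleGluing_strictMonoOn (κ : Bool) (v : τ.BdryVertex) :
    StrictMonoOn (F.poleGluing κ v) (Icc 0 (τ.leftSize v)) := by
  intro x hx y hy hxy
  cases κ with
  | true => simpa [poleGluing] using F.gluing_strictMonoOn v hx hy hxy
  | false =>
    have := F.gluing_strictMonoOn v (a := τ.leftSize v - y) (b := τ.leftSize v - x)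
      ⟨by linarith [hy.2], by linarith [hy.1]⟩ ⟨by linarith [hx.2], by linarith [hx.1]⟩
      (by linarith)
    simpa [poleGluing] using this

theorem poleGluing_zero (κ : Bool) (v : τ.BdryVertex) : F.poleGluing κ v 0 = 0 := by
  cases κ <;> simp [poleGluing, F.gluing_zero, F.gluing_leftSize]

theorem poleGluing_leftSize (κ : Bool) (v : τ.BdryVertex) :
    F.poleGluing κ v (τ.leftSize v) = τ.rightSize v := by
  cases κ <;> simp [poleGluing, F.gluing_zero, F.gluing_leftSize]

theorem poleGluing_rev (κ : Bool) (c : BdryCorner T) {x : ℝ}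
    (hx : x ∈ Icc (0 : ℝ) (τ.leftSize (τ.vertex c))) :
    F.poleGluing κ (τ.vertex c.rev) (F.poleGluing κ (τ.vertex c) x) = x := by
  obtain ⟨h1, h2⟩ := F.size_rev c
  cases κ with
  | true => simpa [poleGluing] using (F.gluing_rev c hx).2
  | false =>
    have := (F.gluing_rev c (x := τ.leftSize (τ.vertex c) - x)
      ⟨by linarith [hx.2], by linarith [hx.1]⟩).2
    simp [poleGluing, h1, h2, this]

end HolonomySolution

/-! ### The model of a ladderpole -/

variable [Finite T] {D : τ.Drawing}

namespace PoleIndex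

variable {κ : Bool} (F : τ.HolonomySolution) (I : PoleIndex D κ)

/-- The foliation near the ladderpole of colour `κ`. -/
def model : PoleModel where
  V := (τ.colVertices κ).card
  n j := τ.leftSize (I.a j)
  m j := τ.rightSize (I.a j)
  f j := F.poleGluing κ (I.a j)
  L := (exists_int_sum (fun j => (τ.leftSize (I.a j) : ℤ) - 1) 0).choose
  R := (exists_int_sum (fun j => (τ.rightSize (I.a j) : ℤ) - 1) 0).choose
  two_le_n j := by rw [← fanSize_false]; exact τ.two_le_fanSize _ _
  two_le_m j := by rw [← fanSize_true]; exact τ.two_le_fanSize _ _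
  f_mono j := F.poleGluing_strictMonoOn κ _
  f_zero j := F.poleGluing_zero κ _
  f_top j := F.poleGluing_leftSize κ _
  L_succ j := by
    rw [(exists_int_sum (fun j => (τ.leftSize (I.a j) : ℤ) - 1) 0).choose_spec.2 j, add_sub_assoc]
  R_succ j := by
    rw [(exists_int_sum (fun j => (τ.rightSize (I.a j) : ℤ) - 1) 0).choose_spec.2 j, add_sub_assoc]
  n_period j := by rw [I.a_period]
  m_period j := by rw [I.a_period]
  f_period j := by rw [I.a_period]
  -- the dual vertex is the other end of the edge of the triangulation
  dual j := by
    obtain ⟨c, hc⟩ : ∃ c, τ.vertex c = I.a j := Quotient.exists_rep _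
    have hκ : τ.vcol (τ.vertex c.rev) = κ := by
      rw [vcol_vertex, col_rev, ← vcol_vertex, hc, I.vcol_a]
    have hV : (0 : ℤ) < (τ.colVertices κ).card := by exact_mod_cast I.card_pos
    set V : ℤ := ((τ.colVertices κ).card : ℤ) with hVdef
    set t : ℤ := -((I.J (τ.vertex c.rev) 0 - j) / V) with ht
    set j' := I.J (τ.vertex c.rev) (t * colSign κ) with hj'
    have e1 : j' = I.J (τ.vertex c.rev) 0 + t * V := by
      rw [hj', I.J_eq _ _ hκ, ← hVdef]
      linear_combination t * V * colSign_mul_self κ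
    have e2 : j' - j = (I.J (τ.vertex c.rev) 0 - j) % V := by
      rw [e1, Int.emod_def, ht]
      ring
    have e3 := Int.emod_nonneg (I.J (τ.vertex c.rev) 0 - j) hV.ne'
    have e4 := Int.emod_lt_of_pos (I.J (τ.vertex c.rev) 0 - j) hV
    have ha : I.a j' = τ.vertex c.rev := I.a_J _ _ hκ
    have hne : j' ≠ j := by
      intro h
      rw [h, ← hc] at ha
      exact τ.vertex_rev_ne c ha.symm
    refine ⟨j', by omega, by omega, ?_, ?_, ?_⟩
    · rw [ha, ← hc, (F.size_rev c).1]
    · rw [ha, ← hc, (F.size_rev c).2]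
    · intro x hx
      rw [← hc] at hx
      rw [ha, ← hc]
      exact F.poleGluing_rev κ c hx

/-- The number of the rung `c` that leaves the ladderpole to the right from the sheet `W`. -/
def exitIdx (c : BdryCorner T) (W : ℤ) : ℤ :=
  (I.model F).R (I.J (τ.vertex c) W) + τ.polePos c

/-- The number of the rung that arrives from the left at its right end `c` in the sheet `W`. -/
def entryIdx (c : BdryCorner T) (W : ℤ) : ℤ :=
  (I.model F).L (I.J (τ.vertex c) W) + (τ.leftSize (τ.vertex c) - 1 - τ.polePos c) - 1

theorem exitIdx_next {c : BdryCorner T} (hc : ¬ τ.IsPole c) (hs : τ.side c = true)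
    (hκ : τ.col c = κ) (W : ℤ) :
    I.exitIdx F (τ.nextRung c) (W + D.nextSheet c) = I.exitIdx F c W + colSign κ := by
  unfold exitIdx
  rcases D.nextRung_cases hc with ⟨h1, h2, h3⟩ | ⟨d, hd, hv, hv', hw, h⟩
  · rw [h1, h2, h3, add_zero, hκ, add_assoc]
  · have hcold : τ.col d = κ := (τ.col_eq_of_vertex_eq hv).trans hκ
    rw [hv', hw]
    rcases h with ⟨h1, h2, h3, h4⟩ | ⟨h1, h2, h3, h4⟩
    · have hJ := I.J_opp d W (h2.trans hs) hd hcold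
      have hR : (I.model F).R _ = _ + (τ.rightSize (I.a _) : ℤ) - 1 :=
        (I.model F).R_succ (I.J (τ.vertex d) W)
      rw [I.a_J (τ.vertex d) _ hcold] at hR
      rw [hJ, hR, hv, h3]
      rw [hs, fanSize_true] at h4
      have hsign : colSign κ = 1 := by rw [← hκ, h1]; rfl
      rw [hsign]
      linarith
    · have hsd : τ.side d = false := by rw [h2, hs]; rfl
      have hJ := I.J_opp (τ.opp d) (W + D.wrap d) (by rw [side_opp, hsd]; rfl)
        ((τ.isPole_opp d).2 hd) (by rw [col_opp, ← (τ.isPole_iff d).1 hd, hcold])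
      rw [τ.opp_opp, D.wrap_opp, add_neg_cancel_right, hv] at hJ
      have hR : (I.model F).R _ = _ + (τ.rightSize (I.a _) : ℤ) - 1 :=
        (I.model F).R_succ (I.J (τ.vertex (τ.opp d)) (W + D.wrap d))
      rw [I.a_J _ _ (by rw [vcol_vertex, col_opp, ← (τ.isPole_iff d).1 hd, hcold]), ← hJ] at hR
      rw [hR, h3]
      rw [hs, fanSize_true, hv'] at h4
      have hsign : colSign κ = -1 := by rw [← hκ, h1]; rfl
      rw [hsign]
      linarith

theorem entryIdx_next {c : BdryCorner T} (hc : ¬ τ.IsPole c) (hs : τ.side c = false)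
    (hκ : τ.col c = κ) (W : ℤ) :
    I.entryIdx F (τ.nextRung c) (W + D.nextSheet c) = I.entryIdx F c W - colSign κ := by
  unfold entryIdx
  rcases D.nextRung_cases hc with ⟨h1, h2, h3⟩ | ⟨d, hd, hv, hv', hw, h⟩
  · rw [h1, h2, h3, add_zero, hκ]
    ring
  · have hcold : τ.col d = κ := (τ.col_eq_of_vertex_eq hv).trans hκ
    rw [hv', hw]
    rcases h with ⟨h1, h2, h3, h4⟩ | ⟨h1, h2, h3, h4⟩
    · have hsd : τ.side d = false := h2.trans hs
      have hJ := I.J_opp (τ.opp d) (W + D.wrap d) (by rw [side_opp, hsd]; rfl)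
        ((τ.isPole_opp d).2 hd) (by rw [col_opp, ← (τ.isPole_iff d).1 hd, hcold])
      rw [τ.opp_opp, D.wrap_opp, add_neg_cancel_right, hv] at hJ
      have hL : (I.model F).L _ = _ + (τ.leftSize (I.a _) : ℤ) - 1 :=
        (I.model F).L_succ (I.J (τ.vertex (τ.opp d)) (W + D.wrap d))
      rw [I.a_J _ _ (by rw [vcol_vertex, col_opp, ← (τ.isPole_iff d).1 hd, hcold]), ← hJ] at hL
      rw [hL, h3]
      rw [hs, fanSize_false] at h4
      have hsign : colSign κ = 1 := by rw [← hκ, h1]; rfl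
      rw [hsign]
      linarith
    · have hJ := I.J_opp d W (by rw [h2, hs]; rfl) hd hcold
      have hL : (I.model F).L _ = _ + (τ.leftSize (I.a _) : ℤ) - 1 :=
        (I.model F).L_succ (I.J (τ.vertex d) W)
      rw [I.a_J (τ.vertex d) _ hcold] at hL
      rw [hJ, hL, hv, h3]
      rw [hs, fanSize_false, hv'] at h4
      have hsign : colSign κ = -1 := by rw [← hκ, h1]; rfl
      rw [hsign]
      linarith

/-- A lifted rung is determined by its number. -/
theorem exitIdx_injective {c d : BdryCorner T} {W W' : ℤ} (hc : ¬ τ.IsPole c) (hd : ¬ τ.IsPole d)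
    (hsc : τ.side c = true) (hsd : τ.side d = true) (hκc : τ.col c = κ) (hκd : τ.col d = κ)
    (h : I.exitIdx F c W = I.exitIdx F d W') : c = d ∧ W = W' := by
  have key : ∀ (c : BdryCorner T) (W : ℤ), ¬ τ.IsPole c → τ.side c = true → τ.col c = κ →
      (I.model F).R (I.J (τ.vertex c) W) ≤ I.exitIdx F c W ∧
        I.exitIdx F c W < (I.model F).R (I.J (τ.vertex c) W + 1) := by
    intro c W hc hs hκ
    have h1 := τ.polePos_nonneg c
    have h2 := τ.polePos_lt c
    rw [isPole_iff_polePos] at hc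
    have hR : (I.model F).R _ = _ + (τ.rightSize (I.a _) : ℤ) - 1 :=
      (I.model F).R_succ (I.J (τ.vertex c) W)
    rw [I.a_J (τ.vertex c) _ hκ] at hR
    rw [hs, fanSize_true] at h2 hc
    unfold exitIdx
    omega
  obtain ⟨a1, a2⟩ := key c W hc hsc hκc
  obtain ⟨b1, b2⟩ := key d W' hd hsd hκd
  have hmono := (I.model F).R_strictMono
  have hJ : I.J (τ.vertex c) W = I.J (τ.vertex d) W' := by
    have l1 := hmono.lt_iff_lt.1 ((a1.trans_eq h).trans_lt b2)
    have l2 := hmono.lt_iff_lt.1 ((b1.trans_eq h.symm).trans_lt a2)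
    omega
  obtain ⟨hv, hW⟩ := I.J_injective (v := τ.vertex c) (v' := τ.vertex d) hκc hκd hJ
  refine ⟨τ.polePos_injective hv (hsc.trans hsd.symm) ?_, hW⟩
  unfold exitIdx at h
  rw [hJ] at h
  linarith

/-- From left to right, the height increases along a red ladderpole and decreases along a blue
one. -/
theorem height_le {T : Type*} [Fintype T] {τ : VeeringTriangulation T} {D : τ.Drawing} {κ : Bool}
    (I : PoleIndex D κ) (hD : D.IsStandard) {v v' : τ.BdryVertex} {W W' : ℤ}
    (hv : τ.vcol v = κ) (hv' : τ.vcol v' = κ) (d : ℕ) (h : I.J v' W' = I.J v W + d) :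
    0 ≤ (colSign κ : ℝ) * ((D.height v' + W') - (D.height v + W)) := by
  induction d generalizing v' W' with
  | zero =>
    rw [Nat.cast_zero, add_zero] at h
    obtain ⟨rfl, rfl⟩ := I.J_injective hv' hv h
    simp
  | succ d ih =>
    set j := I.J v W + d with hj
    obtain ⟨W₁, hW₁⟩ := I.exists_J_eq j
    have h1 := ih (I.vcol_a j) hW₁
    have hcol : τ.col (τ.rightPole (I.a j)) = κ := by
      rw [← vcol_vertex, τ.vertex_rightPole, I.vcol_a]
    have h2 := I.J_opp _ W₁ (τ.side_rightPole (I.a j)) (τ.isPole_rightPole _) hcol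
    rw [τ.vertex_rightPole, hW₁, hj, add_assoc, ← Nat.cast_succ, ← h] at h2
    rw [← τ.poleNext_apply] at h2
    obtain ⟨e1, e2⟩ := I.J_injective (by rw [vcol_poleNext, I.vcol_a]) hv' h2
    have h3 := hD.rise_pole_pos (τ.side_rightPole (I.a j)) (τ.isPole_rightPole _)
    rw [hcol, Drawing.rise_rightPole, e1] at h3
    rw [← e2]
    push_cast
    linarith

/-- Within one period of the ladderpole, the height changes by at most `1`. -/
theorem height_le_one {T : Type*} [Fintype T] {τ : VeeringTriangulation T} {D : τ.Drawing}
    {κ : Bool} (I : PoleIndex D κ) (hD : D.IsStandard) {v v' : τ.BdryVertex} {W W' : ℤ}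
    (hv : τ.vcol v = κ) (hv' : τ.vcol v' = κ) (d : ℕ) (h : I.J v' W' = I.J v W + d)
    (hd : d ≤ (τ.colVertices κ).card) :
    (colSign κ : ℝ) * ((D.height v' + W') - (D.height v + W)) ≤ 1 := by
  have h1 : I.J v (W + colSign κ) = I.J v' W' + ((τ.colVertices κ).card - d : ℕ) := by
    rw [h, I.J_eq v _ hv, I.J_eq v W hv]
    push_cast [hd]
    linear_combination ((τ.colVertices κ).card : ℤ) * colSign_mul_self κ
  have h2 := I.height_le hD hv' hv _ h1
  push_cast at h2
  linarith [colSign_mul_self_real κ]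

end PoleIndex

/-! ### Ladders join the two ladderpoles -/

variable (F : τ.HolonomySolution) (I : ∀ κ, PoleIndex D κ)

theorem exists_rung (κ : Bool) (I : PoleIndex D κ) :
    ∃ c, ¬ τ.IsPole c ∧ τ.side c = true ∧ τ.col c = κ := by
  have h := τ.two_le_fanSize true (I.a 0)
  obtain ⟨c, h1, h2, h3⟩ := τ.exists_polePos_eq true (I.a 0) 0 (by omega)
  refine ⟨c, ?_, h2, ?_⟩
  · rw [isPole_iff_polePos, h2, h1, h3]
    push_cast
    omega
  · rw [← vcol_vertex, h1, I.vcol_a]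

/-- The rungs of a ladder are numbered in the opposite orders at the two sides of the ladder. -/
theorem exists_ladder_const (κ : Bool) : ∃ C : ℤ, ∀ c W, ¬ τ.IsPole c → τ.side c = true →
    τ.col c = κ →
    (I κ).exitIdx F c W + (I (!κ)).entryIdx F (τ.opp c) (W + D.wrap c) = C := by
  have key : ∀ (t : ℕ) c W d W', ¬ τ.IsPole c → τ.side c = true → τ.col c = κ →
      ¬ τ.IsPole d → τ.side d = true → τ.col d = κ →
      (I κ).exitIdx F d W' = (I κ).exitIdx F c W + t * colSign κ →
      (I κ).exitIdx F c W + (I (!κ)).entryIdx F (τ.opp c) (W + D.wrap c) =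
        (I κ).exitIdx F d W' + (I (!κ)).entryIdx F (τ.opp d) (W' + D.wrap d) := by
    intro t
    induction t with
    | zero =>
      intro c W d W' hc hs hκ hd hs' hκ' h
      rw [Nat.cast_zero, zero_mul, add_zero] at h
      obtain ⟨rfl, rfl⟩ := (I κ).exitIdx_injective F hd hc hs' hs hκ' hκ h
      rfl
    | succ t ih =>
      intro c W d W' hc hs hκ hd hs' hκ' h
      have hu := τ.nextRung_spec hc
      have h1 := (I κ).exitIdx_next F hc hs hκ W
      rw [← ih _ (W + D.nextSheet c) d W' hu.1 (hu.2.1.trans hs) (hu.2.2.trans hκ) hd hs' hκ'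
        (by rw [h, h1]; push_cast; ring)]
      have h2 := (I (!κ)).entryIdx_next F (c := τ.opp (τ.nextRung c))
        (by rw [isPole_opp]; exact hu.1) (by rw [side_opp, hu.2.1, hs]; rfl)
        (by rw [col_opp, τ.col_next_ne hu.1, hu.2.2, hκ])
        (W + D.nextSheet c + D.wrap (τ.nextRung c))
      rw [τ.nextRung_opp_nextRung hc] at h2
      have h3 := D.nextSheet_opp hc
      rw [show W + D.nextSheet c + D.wrap (τ.nextRung c) +
        D.nextSheet (τ.opp (τ.nextRung c)) = W + D.wrap c by rw [← h3]; ring, colSign_not] at h2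
      rw [h1, h2]
      ring
  obtain ⟨c₀, hc₀, hs₀, hκ₀⟩ := exists_rung κ (I κ)
  refine ⟨(I κ).exitIdx F c₀ 0 + (I (!κ)).entryIdx F (τ.opp c₀) (0 + D.wrap c₀),
    fun c W hc hs hκ => ?_⟩
  rcases le_total 0 (((I κ).exitIdx F c₀ 0 - (I κ).exitIdx F c W) * colSign κ) with h | h
  · refine key (((I κ).exitIdx F c₀ 0 - (I κ).exitIdx F c W) * colSign κ).toNat c W c₀ 0
      hc hs hκ hc₀ hs₀ hκ₀ ?_
    rw [Int.toNat_of_nonneg h]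
    linear_combination (-(I κ).exitIdx F c₀ 0 + (I κ).exitIdx F c W) * colSign_mul_self κ
  · refine (key (-(((I κ).exitIdx F c₀ 0 - (I κ).exitIdx F c W) * colSign κ)).toNat c₀ 0 c W
      hc₀ hs₀ hκ₀ hc hs hκ ?_).symm
    rw [Int.toNat_of_nonneg (by linarith)]
    linear_combination ((I κ).exitIdx F c₀ 0 - (I κ).exitIdx F c W) * colSign_mul_self κ

/-- The number of rungs in the ladder on the right of the ladderpole of colour `κ`. -/
def rungCount (κ : Bool) : ℤ := ((I κ).model F).R ((I κ).model F).V - ((I κ).model F).R 0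

theorem PoleIndex.J_add_colSign {κ : Bool} (I : PoleIndex D κ) {v : τ.BdryVertex}
    (hv : τ.vcol v = κ) (W : ℤ) :
    I.J v (W + colSign κ) = I.J v W + (τ.colVertices κ).card := by
  rw [I.J_eq v _ hv, I.J_eq v W hv]
  linear_combination ((τ.colVertices κ).card : ℤ) * colSign_mul_self κ

theorem exitIdx_add_colSign {κ : Bool} {c : BdryCorner T} (hκ : τ.col c = κ) (W : ℤ) :
    (I κ).exitIdx F c (W + colSign κ) = (I κ).exitIdx F c W + rungCount F I κ := by
  unfold PoleIndex.exitIdx rungCount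
  rw [(I κ).J_add_colSign (v := τ.vertex c) hκ]
  have := ((I κ).model F).R_period ((I κ).J (τ.vertex c) W)
  rw [show ((I κ).model F).V = (τ.colVertices κ).card from rfl] at this ⊢
  rw [this]
  ring

theorem entryIdx_add_colSign {κ : Bool} {c : BdryCorner T} (hκ : τ.col c = κ) (W : ℤ) :
    (I κ).entryIdx F c (W + colSign κ) = (I κ).entryIdx F c W +
      (((I κ).model F).L ((I κ).model F).V - ((I κ).model F).L 0) := by
  unfold PoleIndex.entryIdx
  rw [(I κ).J_add_colSign (v := τ.vertex c) hκ]
  have := ((I κ).model F).L_period ((I κ).J (τ.vertex c) W)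
  rw [show ((I κ).model F).V = (τ.colVertices κ).card from rfl] at this ⊢
  rw [this]
  ring

/-- The ladder on the right of a ladderpole is on the left of the other one. -/
theorem rungCount_eq (κ : Bool) :
    ((I (!κ)).model F).L ((I (!κ)).model F).V - ((I (!κ)).model F).L 0 = rungCount F I κ := by
  obtain ⟨C, hC⟩ := exists_ladder_const F I κ
  obtain ⟨c, hc, hs, hκ⟩ := exists_rung κ (I κ)
  have h1 := hC c (0 + colSign κ) hc hs hκ
  have h2 := hC c 0 hc hs hκ
  have h3 := entryIdx_add_colSign F I (κ := !κ) (c := τ.opp c)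
    (by rw [col_opp, τ.col_next_ne hc, hκ]) (0 + colSign κ + D.wrap c)
  rw [exitIdx_add_colSign F I hκ] at h1
  rw [colSign_not, show 0 + colSign κ + D.wrap c + -colSign κ = 0 + D.wrap c by ring] at h3
  linarith

end VeeringTriangulation

namespace VeeringTriangulation

/-! ### Integral curves -/

/-- The height on a strip, turned upside down for blue. -/
def flipHeight (κ : Bool) (s : ℝ) : ℝ := if κ then s else 1 - s

theorem flipHeight_nonneg (κ : Bool) {s : ℝ} (hs : s ∈ Icc (0 : ℝ) 1) : 0 ≤ flipHeight κ s := by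
  cases κ <;> simp [flipHeight, hs.1, hs.2]

theorem flipHeight_le_one (κ : Bool) {s : ℝ} (hs : s ∈ Icc (0 : ℝ) 1) : flipHeight κ s ≤ 1 := by
  cases κ <;> simp [flipHeight, hs.1, hs.2]

theorem flipHeight_not (κ : Bool) (s : ℝ) : flipHeight (!κ) s = 1 - flipHeight κ s := by
  cases κ <;> simp [flipHeight]

variable {T : Type*} {τ : VeeringTriangulation T}

/-- The height at which a leaf that arrives at the right end `e` of a strip at the height `s` hits
the left fan, when the fan is turned upside down at blue vertices. -/
def arrival (e : BdryCorner T) (s : ℝ) : ℝ :=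
  (τ.leftSize (τ.vertex e) - 1 - τ.polePos e : ℝ) + flipHeight (τ.col e) s

variable [Finite T]

theorem leftPos_lt {e : BdryCorner T} (he : τ.side e = false) :
    τ.leftPos e < τ.leftSize (τ.vertex e) := by
  have := τ.leftPos_add_fanPos he
  rw [fanSize_false] at this
  omega

/-- The gluing of the two fans, with positions counted towards the ladderpole. -/
theorem poleGluing_arrival (F : τ.HolonomySolution) {e c : BdryCorner T} {s s' : ℝ}
    (he : τ.side e = false) (hc : τ.side c = true) (hv : τ.vertex c = τ.vertex e)
    (h : F.gluing (τ.vertex e) (τ.leftPos e + s) = τ.rightPos c + s') :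
    F.poleGluing (τ.col e) (τ.vertex e) (arrival (τ := τ) e s) =
      τ.polePos c + flipHeight (τ.col e) s' := by
  have h1 := τ.leftPos_add_fanPos he
  rw [fanSize_false] at h1
  have h2 : (τ.leftPos e : ℝ) + τ.fanPos e + 1 = τ.leftSize (τ.vertex e) := by exact_mod_cast h1
  have hcol := τ.col_eq_of_vertex_eq hv
  rw [rightPos_eq _ hc] at h
  unfold arrival
  cases hκ : τ.col e with
  | true =>
    rw [polePos_of_red _ hκ, polePos_of_red _ (hcol.trans hκ)]
    simp only [HolonomySolution.poleGluing, flipHeight, if_true, Int.cast_natCast]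
    rw [← h]
    congr 1
    linarith
  | false =>
    rw [polePos_of_blue _ hκ, polePos_of_blue _ (hcol.trans hκ), he, hc, fanSize_false,
      fanSize_true, hv]
    simp only [HolonomySolution.poleGluing, flipHeight, Bool.false_eq_true, if_false]
    push_cast
    rw [show (τ.leftSize (τ.vertex e) : ℝ) - (τ.leftSize (τ.vertex e) - 1 -
      (τ.leftSize (τ.vertex e) - 1 - τ.fanPos e) + (1 - s)) = τ.leftPos e + s by linarith, h]
    ring

theorem arrival_of_isPole {e : BdryCorner T} (he : τ.side e = false) (hp : τ.IsPole e) (s : ℝ) :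
    arrival (τ := τ) e s = flipHeight (τ.col e) s := by
  rw [isPole_iff_polePos, he, fanSize_false] at hp
  have : (τ.polePos e : ℝ) + 1 = τ.leftSize (τ.vertex e) := by exact_mod_cast hp
  unfold arrival
  linarith

theorem arrival_of_not_isPole {e : BdryCorner T} (he : τ.side e = false) (hp : ¬ τ.IsPole e) {s : ℝ}
    (hs : s ∈ Icc (0 : ℝ) 1) :
    1 ≤ arrival (τ := τ) e s ∧ arrival (τ := τ) e s ≤ τ.leftSize (τ.vertex e) := by
  have h0 := τ.polePos_nonneg e
  have h1 := τ.polePos_lt e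
  rw [isPole_iff_polePos] at hp
  rw [he, fanSize_false] at hp h1
  have h2 : τ.polePos e + 2 ≤ τ.leftSize (τ.vertex e) := by omega
  have h3 : (τ.polePos e : ℝ) + 2 ≤ τ.leftSize (τ.vertex e) := by exact_mod_cast h2
  have h4 : (0 : ℝ) ≤ τ.polePos e := by exact_mod_cast h0
  have h5 := flipHeight_nonneg (τ.col e) hs
  have h6 := flipHeight_le_one (τ.col e) hs
  unfold arrival
  constructor <;> linarith

namespace IntegralCurve

variable {F : τ.HolonomySolution} {D : τ.Drawing} (γ : IntegralCurve F D)

omit [Finite T] in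
theorem side_c (n : ℤ) : τ.side (γ.c n) = true := γ.isRight n

omit [Finite T] in
theorem side_opp_c (n : ℤ) : τ.side (τ.opp (γ.c n)) = false := by
  rw [side_opp, γ.side_c]; rfl

omit [Finite T] in
theorem col_opp_c (n : ℤ) : τ.col (τ.opp (γ.c n)) = τ.col (γ.c (n + 1)) :=
  τ.col_eq_of_vertex_eq (γ.vertex_succ n).symm

omit [Finite T] in
/-- The sheets of the vertices that the curve visits; they determine the heights up to a constant,
since the curve starts at an arbitrary point of the plane. -/
theorem exists_sheet : ∃ W : ℤ → ℤ, (∀ n, W (n + 1) = W n + D.wrap (γ.c n)) ∧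
    ∀ n, γ.y n = γ.y 0 - D.height (τ.vertex (γ.c 0)) + (D.height (τ.vertex (γ.c n)) + W n) := by
  obtain ⟨W, h0, hW⟩ := exists_int_sum (fun n => D.wrap (γ.c n)) 0
  refine ⟨W, hW, fun n => ?_⟩
  have := eq_apply_zero_of_forall_succ_eq (fun n => γ.y n - (D.height (τ.vertex (γ.c n)) + W n))
    (fun n => by
      simp only [γ.y_succ, hW, Drawing.rise, γ.vertex_succ]
      push_cast
      ring) n
  simp only [h0, Int.cast_zero] at this
  linarith

theorem poleGluing_arrival (n : ℤ) :
    F.poleGluing (τ.col (γ.c (n + 1))) (τ.vertex (γ.c (n + 1)))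
      (arrival (τ := τ) (τ.opp (γ.c n)) (γ.s n)) =
      τ.polePos (γ.c (n + 1)) + flipHeight (τ.col (γ.c (n + 1))) (γ.s (n + 1)) := by
  rw [γ.vertex_succ, ← γ.col_opp_c]
  refine VeeringTriangulation.poleGluing_arrival F (γ.side_opp_c n) (γ.side_c _)
    (γ.vertex_succ n) ?_
  obtain ⟨z, h1, h2⟩ := γ.glued n
  rw [← h1, ← h2, F.gluing_of_mem]

omit [Finite T] in
theorem col_of_poles (n : ℤ) (d : ℕ) (h : ∀ i < d, τ.IsPole (γ.c (n + i))) :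
    τ.col (γ.c (n + d)) = τ.col (γ.c n) := by
  induction d with
  | zero => simp
  | succ d ih =>
    rw [← ih fun i hi => h i (by omega), (τ.isPole_iff _).1 (h d (by omega)), ← col_opp, γ.col_opp_c,
      Nat.cast_succ, add_assoc]

omit [Finite T] in
theorem x_of_poles (n : ℤ) (d : ℕ) (h : ∀ i < d, τ.IsPole (γ.c (n + i))) :
    γ.x (n + d) = γ.x n := by
  induction d with
  | zero => simp
  | succ d ih =>
    rw [Nat.cast_succ, ← add_assoc, γ.x_succ, ih fun i hi => h i (by omega), run,
      if_pos (h d (by omega)), add_zero]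

section

variable {W : ℤ → ℤ} (hW : ∀ n, W (n + 1) = W n + D.wrap (γ.c n))

include hW

/-- Along a ladderpole, a curve visits consecutive vertices. -/
theorem J_of_poles {κ : Bool} (I : PoleIndex D κ) (n : ℤ) (hκ : τ.col (γ.c n) = κ) (d : ℕ)
    (h : ∀ i < d, τ.IsPole (γ.c (n + i))) :
    I.J (τ.vertex (γ.c (n + d))) (W (n + d)) = I.J (τ.vertex (γ.c n)) (W n) + d := by
  induction d with
  | zero => simp
  | succ d ih =>
    have h1 := ih fun i hi => h i (by omega)
    have h2 := I.J_opp (γ.c (n + d)) (W (n + d)) (γ.side_c _) (h d (by omega))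
      ((γ.col_of_poles n d fun i hi => h i (by omega)).trans hκ)
    rw [h1, ← γ.vertex_succ, ← hW] at h2
    rw [Nat.cast_succ, ← add_assoc, h2, add_assoc]

/-- An integral curve cannot stay on a ladderpole. -/
theorem exists_not_isPole (I : ∀ κ, PoleIndex D κ) (n : ℤ) :
    ∃ d : ℕ, d ≤ (τ.colVertices (τ.col (γ.c n))).card ∧ ¬ τ.IsPole (γ.c (n + d)) := by
  by_contra! h
  obtain ⟨κ, hκ⟩ : ∃ κ, κ = τ.col (γ.c n) := ⟨_, rfl⟩
  rw [← hκ] at h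
  set J := (I κ).J (τ.vertex (γ.c (n + 1))) (W (n + 1)) with hJ
  have hcol : ∀ i ≤ (τ.colVertices κ).card, τ.col (γ.c (n + (i + 1 : ℕ))) = κ := fun i hi => by
    rw [hκ]
    exact γ.col_of_poles n (i + 1) fun k hk => h k (by omega)
  have harr : ∀ i ≤ (τ.colVertices κ).card,
      arrival (τ := τ) (τ.opp (γ.c (n + i))) (γ.s (n + i)) = flipHeight κ (γ.s (n + i)) := by
    intro i hi
    rw [arrival_of_isPole (γ.side_opp_c _) ((τ.isPole_opp _).2 (h i hi)), γ.col_opp_c]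
    have := hcol i hi
    rw [Nat.cast_succ, ← add_assoc] at this
    rw [this]
  refine ((I κ).model F).not_follows_pole J
    (fun i => arrival (τ := τ) (τ.opp (γ.c (n + i))) (γ.s (n + i))) ?_ ?_
  · intro i hi
    have hi' : i < (τ.colVertices κ).card := hi
    rw [harr i hi'.le]
    exact ⟨flipHeight_nonneg _ (γ.s _).2, flipHeight_le_one _ (γ.s _).2⟩
  · intro i hi
    have hi' : i < (τ.colVertices κ).card := hi
    have e : n + ((i + 1 : ℕ) : ℤ) = n + i + 1 := by push_cast; ring
    have hc := hcol i hi'.le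
    have h1 := γ.J_of_poles hW (I κ) (n + 1)
      (by have := hcol 0 (by omega); simpa using this) i
      (fun k hk => by
        have := h (k + 1) (by omega)
        rwa [show n + ((k + 1 : ℕ) : ℤ) = n + 1 + k by push_cast; ring] at this)
    rw [← hJ, show n + 1 + (i : ℤ) = n + i + 1 by ring] at h1
    rw [e] at hc
    have ha : (I κ).a (J + i) = τ.vertex (γ.c (n + i + 1)) := by
      rw [← h1]
      exact (I κ).a_J _ _ hc
    have hg := γ.poleGluing_arrival (n + i)
    rw [hc] at hg
    have hp := h (i + 1) (by omega)
    rw [e, isPole_iff_polePos, γ.side_c, fanSize_true] at hp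
    have hp' : (τ.polePos (γ.c (n + i + 1)) : ℝ) + 1 = τ.rightSize (τ.vertex (γ.c (n + i + 1))) := by
      exact_mod_cast hp
    rw [harr (i + 1) (by omega)]
    change (τ.rightSize ((I κ).a (J + i)) : ℝ) - 1 ≤ F.poleGluing κ ((I κ).a (J + i)) _ ∧
      _ = F.poleGluing κ ((I κ).a (J + i)) _ - ((τ.rightSize ((I κ).a (J + i)) : ℝ) - 1)
    rw [ha, hg, e]
    have := flipHeight_nonneg κ (γ.s (n + i + 1)).2
    constructor <;> linarith

/-- The first rung on an integral curve from the `n`-th branch on. -/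
theorem exists_first_rung (I : ∀ κ, PoleIndex D κ) (n : ℤ) :
    ∃ d : ℕ, d ≤ (τ.colVertices (τ.col (γ.c n))).card ∧ ¬ τ.IsPole (γ.c (n + d)) ∧
      ∀ i < d, τ.IsPole (γ.c (n + i)) := by
  classical
  obtain ⟨d, h1, h2⟩ := γ.exists_not_isPole hW I n
  have hex : ∃ d : ℕ, ¬ τ.IsPole (γ.c (n + d)) := ⟨d, h2⟩
  exact ⟨Nat.find hex, (Nat.find_min' hex h2).trans h1, Nat.find_spec hex,
    fun i hi => not_not.1 (Nat.find_min hex hi)⟩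

/-- The part of a curve from a branch to the next rung, in the model of the ladderpole. -/
theorem cross {κ : Bool} (I : PoleIndex D κ) (n : ℤ) (d : ℕ) (hκ : τ.col (γ.c (n + 1)) = κ)
    (h : ∀ i < d, τ.IsPole (γ.c (n + 1 + i))) (hd : ¬ τ.IsPole (γ.c (n + 1 + d))) :
    (I.model F).Cross (I.J (τ.vertex (γ.c (n + 1))) (W (n + 1)))
      (arrival (τ := τ) (τ.opp (γ.c n)) (γ.s n))
      (I.exitIdx F (γ.c (n + 1 + d)) (W (n + 1 + d)) + flipHeight κ (γ.s (n + 1 + d))) := by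
  induction d generalizing n with
  | zero =>
    simp only [Nat.cast_zero, add_zero] at hd ⊢
    have hg := γ.poleGluing_arrival n
    rw [hκ] at hg
    have ha : I.a (I.J (τ.vertex (γ.c (n + 1))) (W (n + 1))) = τ.vertex (γ.c (n + 1)) :=
      I.a_J _ _ hκ
    have hf : (I.model F).f (I.J (τ.vertex (γ.c (n + 1))) (W (n + 1)))
        (arrival (τ := τ) (τ.opp (γ.c n)) (γ.s n)) =
        τ.polePos (γ.c (n + 1)) + flipHeight κ (γ.s (n + 1)) := by
      rw [← hg]
      change F.poleGluing κ (I.a _) _ = _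
      rw [ha]
    have hle := τ.polePos_lt (γ.c (n + 1))
    rw [isPole_iff_polePos] at hd
    rw [γ.side_c, fanSize_true] at hle hd
    have hle2 : τ.polePos (γ.c (n + 1)) + 2 ≤ τ.rightSize (τ.vertex (γ.c (n + 1))) := by omega
    have hle3 : (τ.polePos (γ.c (n + 1)) : ℝ) + 2 ≤ τ.rightSize (τ.vertex (γ.c (n + 1))) := by
      exact_mod_cast hle2
    have hx := PoleModel.Cross.exit (P := I.model F)
      (j := I.J (τ.vertex (γ.c (n + 1))) (W (n + 1)))
      (z := arrival (τ := τ) (τ.opp (γ.c n)) (γ.s n)) (by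
        rw [hf]
        change _ ≤ (τ.rightSize (I.a _) : ℝ) - 1
        rw [ha]
        linarith [flipHeight_le_one κ (γ.s (n + 1)).2])
    rw [hf] at hx
    convert hx using 1
    unfold PoleIndex.exitIdx
    push_cast
    ring
  | succ d ih =>
    have hp0 := h 0 (by omega)
    rw [Nat.cast_zero, add_zero] at hp0
    have hcol : τ.col (γ.c (n + 1 + 1)) = κ := by
      rw [← γ.col_opp_c, col_opp, ← (τ.isPole_iff _).1 hp0, hκ]
    have hih := ih (n + 1) hcol
      (fun i hi => by
        have := h (i + 1) (by omega)
        rwa [show n + 1 + ((i + 1 : ℕ) : ℤ) = n + 1 + 1 + i by push_cast; ring] at this)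
      (by rwa [show n + 1 + ((d + 1 : ℕ) : ℤ) = n + 1 + 1 + d by push_cast; ring] at hd)
    rw [show n + 1 + ((d + 1 : ℕ) : ℤ) = n + 1 + 1 + d by push_cast; ring]
    have hJ := I.J_opp (γ.c (n + 1)) (W (n + 1)) (γ.side_c _) hp0 hκ
    rw [← γ.vertex_succ, ← hW] at hJ
    rw [hJ, arrival_of_isPole (γ.side_opp_c _) ((τ.isPole_opp _).2 hp0), γ.col_opp_c, hcol] at hih
    refine PoleModel.Cross.pass ?_ (flipHeight_nonneg κ (γ.s (n + 1)).2)
      (flipHeight_le_one κ (γ.s (n + 1)).2) hih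
    have hg := γ.poleGluing_arrival n
    rw [hκ] at hg
    have ha : I.a (I.J (τ.vertex (γ.c (n + 1))) (W (n + 1))) = τ.vertex (γ.c (n + 1)) :=
      I.a_J _ _ hκ
    change F.poleGluing κ (I.a _) _ = (τ.rightSize (I.a _) : ℝ) - 1 + _
    rw [ha, hg]
    rw [isPole_iff_polePos, γ.side_c, fanSize_true] at hp0
    have hp' : (τ.polePos (γ.c (n + 1)) : ℝ) + 1 = τ.rightSize (τ.vertex (γ.c (n + 1))) := by
      exact_mod_cast hp0
    linarith

end

end IntegralCurve

end VeeringTriangulation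

namespace VeeringTriangulation

/-! ### Turns around the boundary torus -/

variable {T : Type*} [Fintype T] {τ : VeeringTriangulation T} {D : τ.Drawing}

section

variable (F : τ.HolonomySolution) (I : ∀ κ, PoleIndex D κ)

/-- The constant that relates the numberings of the rungs of a ladder at its two sides. -/
def ladderConst (κ : Bool) : ℤ := (exists_ladder_const F I κ).choose

theorem exitIdx_add_entryIdx {κ : Bool} {c : BdryCorner T} (W : ℤ) (hc : ¬ τ.IsPole c)
    (hs : τ.side c = true) (hκ : τ.col c = κ) :
    (I κ).exitIdx F c W + (I (!κ)).entryIdx F (τ.opp c) (W + D.wrap c) = ladderConst F I κ :=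
  (exists_ladder_const F I κ).choose_spec c W hc hs hκ

/-- The holonomy from the ladder on the right of the ladderpole of colour `κ`, across this ladder
and across the ladderpole of the other colour, to the next ladder. -/
def halfTurn (κ : Bool) (P : ℝ) : ℝ := ((I (!κ)).model F).holonomy (ladderConst F I κ + 1 - P)

/-- The holonomy of the foliation around the boundary torus, from the ladder on the right of the
red ladderpole to its next translate. -/
def turn (P : ℝ) : ℝ := halfTurn F I false (halfTurn F I true P)

theorem halfTurn_antitone (κ : Bool) : Antitone (halfTurn F I κ) := fun _ _ h =>
  PoleModel.holonomy_monotone _ (by linarith)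

theorem halfTurn_sub (κ : Bool) (P : ℝ) :
    halfTurn F I κ (P - rungCount F I κ) = halfTurn F I κ P + rungCount F I (!κ) := by
  have h := ((I (!κ)).model F).holonomy_period (ladderConst F I κ + 1 - P)
  rw [rungCount_eq F I κ] at h
  unfold halfTurn
  rw [show (ladderConst F I κ + 1 - (P - rungCount F I κ) : ℝ) =
    ladderConst F I κ + 1 - P + rungCount F I κ by ring, h]
  rfl

theorem halfTurn_add (κ : Bool) (P : ℝ) :
    halfTurn F I κ (P + rungCount F I κ) = halfTurn F I κ P - rungCount F I (!κ) := by
  have := halfTurn_sub F I κ (P + rungCount F I κ)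
  rw [add_sub_cancel_right] at this
  linarith

theorem rungCount_pos (κ : Bool) : (0 : ℝ) < rungCount F I κ := by
  have h : ((I κ).model F).R 0 < ((I κ).model F).R ((I κ).model F).V :=
    ((I κ).model F).R_strictMono (by
      have : 0 < ((I κ).model F).V := (I κ).card_pos
      exact_mod_cast this)
  have : 0 < rungCount F I κ := sub_pos.2 h
  exact_mod_cast this

/-- The holonomy around the boundary torus, in the coordinate that makes it the lift of a map of
the circle `ℝ / ℤ`. -/
def turnLift : CircleDeg1Lift where
  toFun t := turn F I (rungCount F I true * t) / rungCount F I true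
  monotone' := fun s t h => by
    have hN := rungCount_pos F I true
    refine div_le_div_of_nonneg_right ?_ hN.le
    exact halfTurn_antitone F I false (halfTurn_antitone F I true
      (mul_le_mul_of_nonneg_left h hN.le))
  map_add_one' t := by
    have hN := rungCount_pos F I true
    rw [turn, mul_add, mul_one, halfTurn_add]
    change halfTurn F I false (_ - rungCount F I false) / _ = _
    rw [halfTurn_sub]
    change (turn F I _ + rungCount F I true) / _ = _
    field_simp

theorem turnLift_pow_apply (i : ℕ) (P : ℝ) :
    (turnLift F I ^ i) (P / rungCount F I true) = (turn F I)^[i] P / rungCount F I true := by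
  have hN := (rungCount_pos F I true).ne'
  induction i generalizing P with
  | zero => simp
  | succ i ih =>
    rw [pow_succ, CircleDeg1Lift.mul_apply, Function.iterate_succ_apply, ← ih]
    congr 1
    change turn F I (_ * _) / _ = _
    rw [mul_div_cancel₀ _ hN]

end

/-- The iterates of a lift of a circle map are uniformly close to the multiples of its translation
number. -/
theorem _root_.CircleDeg1Lift.abs_pow_apply_sub_le (f : CircleDeg1Lift) (i : ℕ) (t : ℝ) :
    |(f ^ i) t - t - i * f.translationNumber| ≤ 2 := by
  have h1 := f.dist_pow_map_zero_mul_translationNumber_le i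
  rw [Real.dist_eq, abs_le] at h1
  have h2 := (f ^ i).monotone (Int.floor_le t)
  have h3 := (f ^ i).monotone (Int.lt_floor_add_one t).le
  have h4 := (f ^ i).map_add_int 0 ⌊t⌋
  have h5 := (f ^ i).map_add_int 0 (⌊t⌋ + 1)
  rw [zero_add] at h4 h5
  push_cast at h5
  rw [h4] at h2
  rw [h5] at h3
  have h6 := Int.floor_le t
  have h7 := Int.lt_floor_add_one t
  rw [abs_le]
  constructor <;> linarith

namespace IntegralCurve

variable {F : τ.HolonomySolution} (γ : IntegralCurve F D)

/-- The coordinate along its ladder of the point at which the curve starts along the `n`-th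
branch, a rung, when `W` gives the sheets of the vertices on the curve. -/
def ladderCoord (W : ℤ → ℤ) {κ : Bool} (I : PoleIndex D κ) (n : ℤ) : ℝ :=
  I.exitIdx F (γ.c n) (W n) + flipHeight κ (γ.s n)

section

variable {W : ℤ → ℤ} (hW : ∀ n, W (n + 1) = W n + D.wrap (γ.c n))
  (hy : ∀ n, γ.y n = γ.y 0 - D.height (τ.vertex (γ.c 0)) + (D.height (τ.vertex (γ.c n)) + W n))
  (hD : D.IsStandard) (I : ∀ κ, PoleIndex D κ)

include hW hy hD I in
/-- From a rung to the next rung, which is in the other ladder. -/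
theorem exists_halfTurn {κ : Bool} (a : ℤ) (ha : ¬ τ.IsPole (γ.c a)) (hκ : τ.col (γ.c a) = κ) :
    ∃ d : ℕ, d ≤ (τ.colVertices (!κ)).card ∧ ¬ τ.IsPole (γ.c (a + 1 + d)) ∧
      (∀ i < d, τ.IsPole (γ.c (a + 1 + i))) ∧ τ.col (γ.c (a + 1 + d)) = !κ ∧
      γ.ladderCoord W (I (!κ)) (a + 1 + d) = halfTurn F I κ (γ.ladderCoord W (I κ) a) ∧
      γ.x (a + 1 + d) = γ.x a + 1 / 2 ∧
      -1 ≤ colSign (!κ) * (γ.y (a + 1 + d) - γ.y a) ∧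
      colSign (!κ) * (γ.y (a + 1 + d) - γ.y a) ≤ 2 := by
  have hκ' : τ.col (γ.c (a + 1)) = !κ := by
    rw [← γ.col_opp_c, col_opp, τ.col_next_ne ha, hκ]
  obtain ⟨d, h1, h2, h3⟩ := γ.exists_first_rung hW I (a + 1)
  have hcol : τ.col (γ.c (a + 1 + d)) = !κ := (γ.col_of_poles (a + 1) d h3).trans hκ'
  rw [hκ'] at h1
  refine ⟨d, h1, h2, h3, hcol, ?_, ?_, ?_⟩
  · refine PoleModel.Rel.eq_holonomy ⟨_, _, ?_, ?_, ?_, γ.cross hW (I (!κ)) a d hκ' h3 h2⟩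
    · have hlad := exitIdx_add_entryIdx F I (W a) ha (γ.side_c a) hκ
      rw [← hlad, ← hW]
      unfold PoleIndex.entryIdx ladderCoord arrival
      rw [γ.col_opp_c, hκ', flipHeight_not, γ.vertex_succ]
      push_cast
      ring
    · exact (arrival_of_not_isPole (γ.side_opp_c a) (by rwa [isPole_opp]) (γ.s a).2).1
    · have h := (arrival_of_not_isPole (γ.side_opp_c a) (by rwa [isPole_opp]) (γ.s a).2).2
      change _ ≤ (τ.leftSize ((I (!κ)).a _) : ℝ)
      rwa [(I (!κ)).a_J (τ.vertex (γ.c (a + 1))) _ hκ', γ.vertex_succ]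
  · rw [γ.x_of_poles (a + 1) d h3, γ.x_succ, run, if_neg ha]
  · have hJ := γ.J_of_poles hW (I (!κ)) (a + 1) hκ' d h3
    have b1 := (I (!κ)).height_le hD (v := τ.vertex (γ.c (a + 1)))
      (v' := τ.vertex (γ.c (a + 1 + d))) hκ' hcol d hJ
    have b2 := (I (!κ)).height_le_one hD (v := τ.vertex (γ.c (a + 1)))
      (v' := τ.vertex (γ.c (a + 1 + d))) hκ' hcol d hJ h1
    have b3 := hy (a + 1)
    have b4 := hy (a + 1 + d)
    have b5 := γ.y_succ a
    have b6 := abs_le.1 (hD.rung_le (γ.c a) ha)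
    cases κ <;> simp only [colSign, Bool.not_true, Bool.not_false, if_true, Bool.false_eq_true,
      if_false, Int.cast_one, Int.cast_neg] at b1 b2 ⊢ <;> constructor <;> linarith

include hW hy hD I in
/-- From a rung on the right of the red ladderpole to the next such rung. -/
theorem exists_turn (a : ℤ) (ha : ¬ τ.IsPole (γ.c a)) (hκ : τ.col (γ.c a) = true) :
    ∃ b : ℤ, a < b ∧ ¬ τ.IsPole (γ.c b) ∧ τ.col (γ.c b) = true ∧
      (∀ i, a < i → i < b → τ.IsPole (γ.c i) ∨ τ.col (γ.c i) = false) ∧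
      γ.ladderCoord W (I true) b = turn F I (γ.ladderCoord W (I true) a) ∧
      γ.x b = γ.x a + 1 ∧ |γ.y b - γ.y a| ≤ 3 := by
  obtain ⟨d, -, h2, h3, h4, h5, h6, h7, h8⟩ := γ.exists_halfTurn hW hy hD I a ha hκ
  set b := a + 1 + d with hb
  obtain ⟨e, -, k2, k3, k4, k5, k6, k7, k8⟩ := γ.exists_halfTurn hW hy hD I b h2 h4
  simp only [colSign, Bool.not_true, Bool.not_false, if_true, Bool.false_eq_true,
      if_false, Int.cast_one, Int.cast_neg] at h4 h7 h8 k4 k7 k8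
  refine ⟨b + 1 + e, by omega, k2, k4, ?_, ?_, by linarith, ?_⟩
  · intro i hi hi'
    rcases lt_trichotomy i b with h | rfl | h
    · left
      have := h3 (i - (a + 1)).toNat (by omega)
      rwa [show a + 1 + ((i - (a + 1)).toNat : ℤ) = i by omega] at this
    · exact Or.inr h4
    · left
      have := k3 (i - (b + 1)).toNat (by omega)
      rwa [show b + 1 + ((i - (b + 1)).toNat : ℤ) = i by omega] at this
  · rw [turn, ← Bool.not_true, ← h5]
    exact k5
  · rw [abs_le]
    constructor <;> linarith

include hW hy hD I in
/-- Between two rungs on the right of the red ladderpole, a curve makes a whole number of turns. -/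
theorem exists_iterate_turn {a b : ℤ} (hab : a ≤ b) (ha : ¬ τ.IsPole (γ.c a))
    (hκa : τ.col (γ.c a) = true) (hb : ¬ τ.IsPole (γ.c b)) (hκb : τ.col (γ.c b) = true) :
    ∃ i : ℕ, γ.x b = γ.x a + i ∧ |γ.y b - γ.y a| ≤ 3 * i ∧
      γ.ladderCoord W (I true) b = (turn F I)^[i] (γ.ladderCoord W (I true) a) := by
  induction hk : (b - a).toNat using Nat.strong_induction_on generalizing a with
  | _ k ih =>
    rcases hab.eq_or_lt with rfl | hlt
    · exact ⟨0, by simp, by simp, rfl⟩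
    · obtain ⟨a', h1, h2, h3, h4, h5, h6, h7⟩ := γ.exists_turn hW hy hD I a ha hκa
      have hle : a' ≤ b := by
        by_contra hlt'
        rcases h4 b hlt (not_le.1 hlt') with h | h
        · exact hb h
        · rw [hκb] at h; simp at h
      obtain ⟨i, k1, k2, k3⟩ := ih (b - a').toNat (by omega) hle h2 h3 rfl
      refine ⟨i + 1, ?_, ?_, ?_⟩
      · push_cast; linarith
      · rw [abs_le] at *
        push_cast
        constructor <;> linarith
      · rw [k3, h5, Function.iterate_succ_apply]

include hW hy hD I in
/-- A curve makes arbitrarily many turns. -/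
theorem exists_x_eq_add (a : ℤ) (ha : ¬ τ.IsPole (γ.c a)) (hκ : τ.col (γ.c a) = true) (k : ℕ) :
    ∃ b, a ≤ b ∧ ¬ τ.IsPole (γ.c b) ∧ τ.col (γ.c b) = true ∧ γ.x b = γ.x a + k := by
  induction k with
  | zero => exact ⟨a, le_rfl, ha, hκ, by simp⟩
  | succ k ih =>
    obtain ⟨b, h1, h2, h3, h4⟩ := ih
    obtain ⟨b', k1, k2, k3, -, -, k6, -⟩ := γ.exists_turn hW hy hD I b h2 h3
    exact ⟨b', by omega, k2, k3, by push_cast; linarith⟩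

include hW hy hD I in
/-- Starting anywhere on a curve, one soon gets to a rung on the right of the red ladderpole. -/
theorem exists_red_rung (n : ℤ) : ∃ d : ℕ,
    d ≤ (τ.colVertices true).card + (τ.colVertices false).card + 1 ∧
      ¬ τ.IsPole (γ.c (n + d)) ∧ τ.col (γ.c (n + d)) = true := by
  obtain ⟨d, h1, h2, h3⟩ := γ.exists_first_rung hW I n
  have hcol := γ.col_of_poles n d h3
  cases hκ : τ.col (γ.c n) with
  | true =>
    rw [hκ] at h1 hcol
    exact ⟨d, by omega, h2, hcol⟩
  | false =>
    rw [hκ] at h1 hcol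
    obtain ⟨e, k1, k2, -, k4, -⟩ := γ.exists_halfTurn hW hy hD I (n + d) h2 hcol
    refine ⟨d + 1 + e, ?_, ?_, ?_⟩
    · rw [Bool.not_false] at k1; omega
    · rwa [show n + ((d + 1 + e : ℕ) : ℤ) = n + d + 1 + e by push_cast; ring]
    · rwa [show n + ((d + 1 + e : ℕ) : ℤ) = n + d + 1 + e by push_cast; ring]

end

end IntegralCurve

end VeeringTriangulation

namespace VeeringTriangulation

/-! ### The asymptotic slope of a curve -/

theorem tendsto_slopeOf {ι : Type*} {l : Filter ι} {x y : ι → ℝ} {t C : ℝ}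
    (hx : Tendsto (fun n => |x n|) l atTop) (h : ∀ n, |y n - t * x n| ≤ C) :
    Tendsto (fun n => slopeOf (x n) (y n)) l (𝓝 (t : OnePoint ℝ)) := by
  have h1 : Tendsto (fun n => y n / x n) l (𝓝 t) := by
    have h2 : Tendsto (fun n => C / |x n|) l (𝓝 0) := hx.const_div_atTop C
    rw [tendsto_iff_dist_tendsto_zero]
    refine squeeze_zero' (Eventually.of_forall fun _ => dist_nonneg) ?_ h2
    filter_upwards [hx.eventually_gt_atTop 0] with n hn
    rw [Real.dist_eq]
    have hne := abs_pos.1 hn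
    rw [show y n / x n - t = (y n - t * x n) / x n by field_simp, abs_div]
    exact div_le_div_of_nonneg_right (h n) hn.le
  refine ((OnePoint.continuous_coe.tendsto t).comp h1).congr' ?_
  filter_upwards [hx.eventually_gt_atTop 0] with n hn
  rw [slopeOf, if_neg (abs_pos.1 hn)]
  rfl

variable {T : Type*} [Fintype T] {τ : VeeringTriangulation T} {D : τ.Drawing}

namespace IntegralCurve

variable {F : τ.HolonomySolution} (γ : IntegralCurve F D)

omit [Fintype T] in
theorem run_nonneg (c : BdryCorner T) : 0 ≤ τ.run c := by
  unfold run
  split_ifs <;> norm_num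

omit [Fintype T] in
theorem run_le (c : BdryCorner T) : τ.run c ≤ 1 / 2 := by
  unfold run
  split_ifs <;> norm_num

omit [Fintype T] in
theorem monotone_x : Monotone γ.x := monotone_int_of_le_succ fun n => by
  rw [γ.x_succ]
  linarith [run_nonneg (τ := τ) (γ.c n)]

omit [Fintype T] in
theorem x_add_le (n : ℤ) (d : ℕ) : γ.x (n + d) ≤ γ.x n + d := by
  induction d with
  | zero => simp
  | succ d ih =>
    rw [Nat.cast_succ, ← add_assoc, γ.x_succ]
    push_cast
    linarith [run_le (τ := τ) (γ.c (n + d))]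

omit [Fintype T] in
theorem abs_y_add_sub_le {M : ℝ} (hM : ∀ c, |D.rise c| ≤ M) (n : ℤ) (d : ℕ) :
    |γ.y (n + d) - γ.y n| ≤ d * M := by
  induction d with
  | zero => simp
  | succ d ih =>
    rw [Nat.cast_succ, ← add_assoc, γ.y_succ]
    have := hM (γ.c (n + d))
    rw [abs_le] at *
    push_cast
    constructor <;> linarith

section

variable (hD : D.IsStandard) (I : ∀ κ, PoleIndex D κ)

include hD I

/-- A curve stays at a bounded distance from a line whose slope is the translation number of the
holonomy around the torus. -/
theorem exists_abs_sub_le : ∃ C, ∀ n, |γ.y n - (turnLift F I).translationNumber * γ.x n| ≤ C := by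
  obtain ⟨W, hW, hy⟩ := γ.exists_sheet
  set t := (turnLift F I).translationNumber with ht
  set N : ℝ := (rungCount F I true : ℝ) with hN
  have hNpos : 0 < N := rungCount_pos F I true
  obtain ⟨M, hM⟩ : ∃ M, ∀ c, |D.rise c| ≤ M := by
    obtain ⟨M, hM⟩ := (Set.finite_range fun c => |D.rise c|).bddAbove
    exact ⟨M, fun c => hM ⟨c, rfl⟩⟩
  obtain ⟨K, hK⟩ : ∃ K, ∀ c, |D.height (τ.vertex c) - (I true).exitIdx F c 0 / N| ≤ K := by
    obtain ⟨K, hK⟩ := (Set.finite_range fun c =>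
      |D.height (τ.vertex c) - (I true).exitIdx F c 0 / N|).bddAbove
    exact ⟨K, fun c => hK ⟨c, rfl⟩⟩
  -- up to a bounded error, the height of a vertex on the curve is the coordinate on the ladder,
  -- divided by the number of rungs
  have hcoord : ∀ n, τ.col (γ.c n) = true → |D.height (τ.vertex (γ.c n)) + W n -
      γ.ladderCoord W (I true) n / N| ≤ K + 1 / N := by
    intro n hn
    have h1 := eq_apply_zero_of_forall_succ_eq
      (fun k => (I true).exitIdx F (γ.c n) k - k * rungCount F I true) (fun k => by
        have := exitIdx_add_colSign F I hn k
        rw [show colSign true = 1 from rfl] at this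
        simp only [this]
        ring) (W n)
    simp only [zero_mul, sub_zero] at h1
    have h2 : ((I true).exitIdx F (γ.c n) (W n) : ℝ) = (I true).exitIdx F (γ.c n) 0 + W n * N := by
      rw [hN, ← h1]
      push_cast
      ring
    have h3 : D.height (τ.vertex (γ.c n)) + W n - γ.ladderCoord W (I true) n / N =
        D.height (τ.vertex (γ.c n)) - (I true).exitIdx F (γ.c n) 0 / N - (γ.s n : ℝ) / N := by
      unfold ladderCoord
      rw [h2]
      simp only [flipHeight, if_true]
      field_simp
      ring
    have h4 : |(γ.s n : ℝ) / N| ≤ 1 / N := by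
      rw [abs_of_nonneg (div_nonneg (γ.s n).2.1 hNpos.le)]
      exact div_le_div_of_nonneg_right (γ.s n).2.2 hNpos.le
    rw [h3]
    exact (abs_sub _ _).trans (add_le_add (hK _) h4)
  -- the claim for the rungs on the right of the red ladderpole
  have hred : ∀ a b, a ≤ b → ¬ τ.IsPole (γ.c a) → τ.col (γ.c a) = true → ¬ τ.IsPole (γ.c b) →
      τ.col (γ.c b) = true →
      |(γ.y b - t * γ.x b) - (γ.y a - t * γ.x a)| ≤ 2 * (K + 1 / N) + 2 := by
    intro a b hab ha hκa hb hκb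
    obtain ⟨i, h1, -, h3⟩ := γ.exists_iterate_turn hW hy hD I hab ha hκa hb hκb
    have h4 := (turnLift F I).abs_pow_apply_sub_le i (γ.ladderCoord W (I true) a / N)
    rw [turnLift_pow_apply, ← h3] at h4
    have h5 := hcoord a hκa
    have h6 := hcoord b hκb
    have h7 := hy a
    have h8 := hy b
    rw [← hN, ← ht] at h4
    rw [h1, h7, h8]
    rw [abs_le] at *
    constructor <;> linarith
  obtain ⟨d₀, -, ha, hκa⟩ := γ.exists_red_rung hW hy hD I 0
  set a := 0 + (d₀ : ℤ)
  set B := (τ.colVertices true).card + (τ.colVertices false).card + 1 with hB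
  have hM0 : 0 ≤ M := (abs_nonneg _).trans (hM (γ.c 0))
  refine ⟨|γ.y a - t * γ.x a| + (2 * (K + 1 / N) + 2) + (B * M + |t| * B), fun n => ?_⟩
  obtain ⟨d, hd, hb, hκb⟩ := γ.exists_red_rung hW hy hD I n
  have h1 : |(γ.y (n + d) - t * γ.x (n + d)) - (γ.y a - t * γ.x a)| ≤ 2 * (K + 1 / N) + 2 := by
    rcases le_total a (n + d) with h | h
    · exact hred _ _ h ha hκa hb hκb
    · rw [abs_sub_comm]
      exact hred _ _ h hb hκb ha hκa
  have hdB : (d : ℝ) ≤ B := by exact_mod_cast hd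
  have h2 : |γ.y (n + d) - γ.y n| ≤ B * M :=
    (γ.abs_y_add_sub_le hM n d).trans (mul_le_mul_of_nonneg_right hdB hM0)
  have h3 : |t * (γ.x (n + d) - γ.x n)| ≤ |t| * B := by
    rw [abs_mul]
    refine mul_le_mul_of_nonneg_left ?_ (abs_nonneg t)
    have h4 := γ.x_add_le n d
    have h5 : γ.x n ≤ γ.x (n + d) := γ.monotone_x (by omega)
    rw [abs_of_nonneg (by linarith)]
    linarith
  have h6 := abs_le.1 h1
  have h7 := abs_le.1 h2
  have h8 := abs_le.1 h3
  have h9 := neg_abs_le (γ.y a - t * γ.x a)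
  have h10 := le_abs_self (γ.y a - t * γ.x a)
  rw [abs_le]
  constructor <;> linarith

theorem abs_translationNumber_le (γ : IntegralCurve F D) :
    |(turnLift F I).translationNumber| ≤ 3 := by
  obtain ⟨C, hC⟩ := γ.exists_abs_sub_le hD I
  obtain ⟨W, hW, hy⟩ := γ.exists_sheet
  set t := (turnLift F I).translationNumber
  obtain ⟨d₀, -, ha, hκa⟩ := γ.exists_red_rung hW hy hD I 0
  set a := 0 + (d₀ : ℤ)
  have hk : ∀ k : ℕ, k * (|t| - 3) ≤ 2 * C := by
    intro k
    obtain ⟨b, hab, hb, hκb, hx⟩ := γ.exists_x_eq_add hW hy hD I a ha hκa k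
    obtain ⟨i, h1, h2, -⟩ := γ.exists_iterate_turn hW hy hD I hab ha hκa hb hκb
    have hik : (i : ℝ) = k := by linarith
    rw [hik] at h2
    have h3 : |t * k| ≤ 2 * C + 3 * k := by
      have e : t * k = (γ.y b - γ.y a) - ((γ.y b - t * γ.x b) - (γ.y a - t * γ.x a)) := by
        rw [hx]; ring
      have c1 := abs_le.1 (hC a)
      have c2 := abs_le.1 (hC b)
      have c3 := abs_le.1 h2
      rw [e, abs_le]
      constructor <;> linarith
    rw [abs_mul, Nat.abs_cast] at h3
    linarith
  by_contra hlt
  rw [not_le] at hlt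
  obtain ⟨k, hk'⟩ := exists_nat_gt (2 * C / (|t| - 3))
  rw [div_lt_iff₀ (by linarith)] at hk'
  linarith [hk k]

theorem exists_x_add_ge : ∃ B : ℕ, ∀ (n : ℤ) (k : ℕ), γ.x n + k / 2 ≤ γ.x (n + k * B) := by
  obtain ⟨W, hW, hy⟩ := γ.exists_sheet
  refine ⟨(τ.colVertices true).card + (τ.colVertices false).card + 1 + 1, fun n k => ?_⟩
  induction k with
  | zero => simp
  | succ k ih =>
    set B := (τ.colVertices true).card + (τ.colVertices false).card + 1 + 1 with hB
    obtain ⟨d, h1, h2, -⟩ := γ.exists_red_rung hW hy hD I (n + k * B)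
    have h3 := γ.x_succ (n + k * B + d)
    rw [run, if_neg h2] at h3
    have h4 : γ.x (n + k * B) ≤ γ.x (n + k * B + d) := γ.monotone_x (by omega)
    have h5 : γ.x (n + k * B + d + 1) ≤ γ.x (n + (k + 1 : ℕ) * B) :=
      γ.monotone_x (by push_cast; rw [add_mul]; omega)
    push_cast at *
    linarith

theorem tendsto_x_atTop : Tendsto γ.x atTop atTop := by
  obtain ⟨B, hB⟩ := γ.exists_x_add_ge hD I
  refine tendsto_atTop_atTop_of_monotone γ.monotone_x fun b => ?_
  obtain ⟨k, hk⟩ := exists_nat_ge (2 * (b - γ.x 0))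
  exact ⟨0 + k * B, by linarith [hB 0 k]⟩

theorem tendsto_x_atBot : Tendsto γ.x atBot atBot := by
  obtain ⟨B, hB⟩ := γ.exists_x_add_ge hD I
  refine tendsto_atBot_atBot_of_monotone γ.monotone_x fun b => ?_
  obtain ⟨k, hk⟩ := exists_nat_ge (2 * (γ.x 0 - b))
  refine ⟨-(k * B), ?_⟩
  have := hB (-(k * B)) k
  rw [neg_add_cancel] at this
  linarith

end

end IntegralCurve

/-! ### Existence of integral curves -/

theorem exists_eq_natCast_add {x : ℝ} {n : ℕ} (hn : 0 < n) (hx : x ∈ Icc (0 : ℝ) n) :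
    ∃ k < n, ∃ s ∈ Icc (0 : ℝ) 1, x = k + s := by
  rcases hx.2.lt_or_eq with h | rfl
  · refine ⟨⌊x⌋₊, (Nat.floor_lt hx.1).2 h, x - ⌊x⌋₊, ⟨?_, ?_⟩, by ring⟩
    · linarith [Nat.floor_le hx.1]
    · linarith [Nat.lt_floor_add_one x]
  · refine ⟨n - 1, by omega, 1, ⟨zero_le_one, le_rfl⟩, ?_⟩
    rw [Nat.cast_sub hn]
    push_cast
    ring

/-- Through each point there is a leaf. -/
theorem exists_integralCurve [Nonempty T] (F : τ.HolonomySolution) (D : τ.Drawing) :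
    Nonempty (IntegralCurve F D) := by
  let X := {c : BdryCorner T // τ.side c = true} × Icc (0 : ℝ) 1
  let r : X → X → Prop := fun p q => τ.vertex q.1.1 = τ.vertex (τ.opp p.1.1) ∧
    F.gluing (τ.vertex (τ.opp p.1.1)) (τ.leftPos (τ.opp p.1.1) + p.2) = τ.rightPos q.1.1 + q.2
  have hstrip : ∀ e : BdryCorner T, τ.side e = false → ∀ s ∈ Icc (0 : ℝ) 1,
      (τ.leftPos e : ℝ) + s ∈ Icc (0 : ℝ) (τ.leftSize (τ.vertex e)) := by
    intro e he s hs
    have h1 : (τ.leftPos e : ℝ) + 1 ≤ τ.leftSize (τ.vertex e) := by exact_mod_cast leftPos_lt he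
    exact ⟨add_nonneg (Nat.cast_nonneg _) hs.1, by linarith [hs.2]⟩
  have hf : ∀ p, ∃ q, r p q := by
    rintro ⟨⟨c, hc⟩, s, hs⟩
    have hm := τ.two_le_fanSize true (τ.vertex (τ.opp c))
    rw [fanSize_true] at hm
    obtain ⟨k, hk, s', hs', h⟩ := exists_eq_natCast_add (by omega)
      (F.gluing_mem (τ.vertex (τ.opp c)) (τ.leftPos (τ.opp c) + s))
    obtain ⟨d, h1, h2, h3⟩ := (τ.exists_fanPos_eq_iff true _ k).2 hk
    exact ⟨⟨⟨d, h2⟩, s', hs'⟩, h1, by rw [rightPos_eq _ h2, h3]; exact h⟩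
  have hb : ∀ q, ∃ p, r p q := by
    rintro ⟨⟨c, hc⟩, s, hs⟩
    have hn := τ.two_le_fanSize false (τ.vertex c)
    rw [fanSize_false] at hn
    have hw : (τ.rightPos c : ℝ) + s ∈ Icc (0 : ℝ) (τ.rightSize (τ.vertex c)) := by
      have h1 := τ.fanPos_lt c
      rw [hc, fanSize_true, ← rightPos_eq _ hc] at h1
      have h2 : (τ.rightPos c : ℝ) + 1 ≤ τ.rightSize (τ.vertex c) := by exact_mod_cast h1
      exact ⟨add_nonneg (Nat.cast_nonneg _) hs.1, by linarith [hs.2]⟩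
    obtain ⟨z, hz⟩ := (F.f (τ.vertex c)).surjective ⟨_, hw⟩
    obtain ⟨k, hk, s', hs', h⟩ := exists_eq_natCast_add (by omega) z.2
    have hk' : τ.leftSize (τ.vertex c) - 1 - k < τ.fanSize false (τ.vertex c) := by
      rw [fanSize_false]; omega
    obtain ⟨e, h1, h2, h3⟩ := (τ.exists_fanPos_eq_iff false _ _).2 hk'
    have h4 := τ.leftPos_add_fanPos h2
    rw [fanSize_false, h1, h3] at h4
    have h5 : τ.leftPos e = k := by omega
    refine ⟨⟨⟨τ.opp e, by rw [side_opp, h2]; rfl⟩, s', hs'⟩, ?_, ?_⟩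
    · change τ.vertex c = τ.vertex (τ.opp (τ.opp e))
      rw [τ.opp_opp, h1]
    · change F.gluing (τ.vertex (τ.opp (τ.opp e))) (τ.leftPos (τ.opp (τ.opp e)) + s') = _
      rw [τ.opp_opp, h1, h5, ← h, F.gluing_of_mem, hz]
  obtain ⟨t⟩ := ‹Nonempty T›
  obtain ⟨c₀, -, hc₀, -⟩ := τ.exists_pole true (τ.vertex (t, 1))
  obtain ⟨u, -, hu⟩ := exists_int_seq (fun _ => r) (fun _ => hf) (fun _ => hb)
    (⟨⟨c₀, hc₀⟩, 0, le_rfl, zero_le_one⟩ : X)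
  obtain ⟨x, -, hx⟩ := exists_int_sum (fun n => τ.run (u n).1.1) 0
  obtain ⟨y, -, hy⟩ := exists_int_sum (fun n => D.rise (u n).1.1) 0
  refine ⟨⟨fun n => (u n).1.1, fun n => (u n).2, fun n => (u n).1.2, fun n => (hu n).1,
    fun n => ?_, x, y, hx, hy⟩⟩
  refine ⟨⟨_, hstrip (τ.opp (u n).1.1) (by rw [side_opp, (u n).1.2]; rfl) _ (u n).2.2⟩, rfl, ?_⟩
  rw [← F.gluing_of_mem]
  exact (hu n).2

end VeeringTriangulation

end

theorem mainTheorem5 {T : Type*} [Fintype T] (τ : VeeringTriangulation T)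
    (h_cusp : τ.OneCusped)
    (h_up : ∃! q : τ.Ladderpole, τ.IsUpward q)
    (h_down : ∃! q : τ.Ladderpole, τ.IsDownward q)
    (D : τ.Drawing) (hD : D.IsStandard)
    (F : τ.HolonomySolution) :
    ∃ s : ℝ, F.HasBoundarySlope D (s : OnePoint ℝ) ∧ -4 < s ∧ s < 4 := by
  have hT : Nonempty T := by
    have h : Nat.card τ.Cusp ≠ 0 := by
      rw [show Nat.card τ.Cusp = 1 from h_cusp]; exact one_ne_zero
    obtain ⟨q⟩ := (Nat.card_ne_zero.1 h).1
    obtain ⟨p, -⟩ := Quot.exists_rep q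
    exact ⟨p.1⟩
  have hlad : ∀ v w : τ.BdryVertex, τ.vcol v = τ.vcol w → τ.ladderpole v = τ.ladderpole w :=
    fun v w => τ.ladderpole_eq_of_vcol_eq h_up h_down
  let I : ∀ κ, VeeringTriangulation.PoleIndex D κ := fun κ => (hD.exists_poleIndex hlad κ).some
  obtain ⟨γ₀⟩ := VeeringTriangulation.exists_integralCurve F D
  have hs := abs_le.1 (γ₀.abs_translationNumber_le hD I)
  refine ⟨(VeeringTriangulation.turnLift F I).translationNumber, ⟨⟨γ₀⟩, fun γ => ?_⟩,
    by linarith, by linarith⟩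
  obtain ⟨C, hC⟩ := γ.exists_abs_sub_le hD I
  exact ⟨VeeringTriangulation.tendsto_slopeOf (tendsto_abs_atTop_atTop.comp
      (γ.tendsto_x_atTop hD I)) hC,
    VeeringTriangulation.tendsto_slopeOf (tendsto_abs_atBot_atTop.comp
      (γ.tendsto_x_atBot hD I)) hC⟩
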